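/- Throughout, limits are as $x\to\infty$; $\overline U(x)=U((x,\infty))$ for a distribution $U$ on $\mathbb R$; $x_+=\max(x,0)$, $x_-=\max(-x,0)$; $a(x)\sim b(x)$ means $a(x)-b(x)=o(b(x))$ (so $0\sim0$ is allowed, and otherwise $a(x)/b(x)\to1$). Definitions. A distribution $V$ on $[0,\infty)$ is convolution equivalent with index $\alpha\ge0$ if $\overline V(x)>0$ for all $x$, $\overline V(x-y)/\overline V(x)\to \mathrm e^{\alpha y}$ for every $y\in\mathbb R$, and $\overline{V*V}(x)/\overline V(x)$ converges to a finite limit. A distribution $V$ on $\mathbb R$ is convolution equivalent with index $\alpha$ if the distribution with distribution function $V(x)\mathbf 1_{(x\ge0)}$ is. A distribution $U$ on $\mathbb R$ is of strongly regular variation with index $\alpha$, $U\in\mathcal R^*_{-\alpha}$, if $V(x)=1-\overline U(\mathrm e^x)/\overline U(0)$, $x\in\mathbb R$ (the law of $\ln\xi$ given $\xi>0$, where $\xi\sim U$), is convolution equivalent with index $\alpha$. Theorem 2.1. Let $X,X_1,X_2,\dots$ be i.i.d. with law $F$ on $\mathbb R$ and $Y,Y_1,Y_2,\dots$ i.i.d.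 with law $G$ on $(0,\infty)$, the two sequences being independent of each other. Put $S_0=0$, $$S_n=\sum_{i=1}^nX_i\prod_{j=1}^iY_j,\qquad M_n=\max_{0\le k\le n}S_k,\qquad \mu_\alpha=\mathrm E Y^\alpha .$$ Assume that, for some $\alpha\ge0$, $pF+(1-p)G\in\mathcal R^*_{-\alpha}$ for every $0<p<1$. For a random variable $\xi$ write $\mathrm E\xi_+^\alpha=\mathrm E[\xi^\alpha\mathbf 1_{(\xi>0)}]$ (so that $\mathrm E\xi_+^0=\Pr(\xi>0)$), and likewise $\mathrm E M_k^\alpha=\mathrm E[M_k^\alpha\mathbf 1_{(M_k>0)}]$ for $k\in\mathbb N\cup\{\infty\}$. (a) $\mu_\alpha$, $\mathrm E M_n^\alpha$ and $\mathrm E S_{n,+}^\alpha$ are finite for every $n\in\mathbb N=\{1,2,\dots\}$, and $$\Pr(M_n>x)\sim A_n\overline F(x)+B_n\overline G(x),\qquad \Pr(S_n>x)\sim A_n\overline F(x)+C_n\overline G(x),$$ where $$A_n=\sum_{i=1}^n\mu_\alpha^i,\qquad B_n=\sum_{i=1}^n\mu_\alpha^{i-2}\,\mathrm E M_{n-i+1}^\alpha,\qquad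 C_n=\sum_{i=1}^n\mu_\alpha^{i-2}\,\mathrm E S_{n-i+1,+}^\alpha .$$ (b) If $\mu_\alpha<1$, then $M_n$ converges a.s. to a finite limit $M_\infty$, $\mathrm E M_\infty^\alpha<\infty$, and $$\Pr(M_\infty>x)\sim A_\infty\overline F(x)+B_\infty\overline G(x),\qquad A_\infty=\frac{\mu_\alpha}{1-\mu_\alpha},\quad B_\infty=\frac{\mathrm E M_\infty^\alpha}{\mu_\alpha(1-\mu_\alpha)} .$$ (c) If $\mu_\alpha<1$ and $\mathrm E\ln(X_-\vee1)<\infty$, then $S_n$ converges a.s. to a finite limit $S_\infty$, $\mathrm E S_{\infty,+}^\alpha<\infty$, and $$\Pr(S_\infty>x)\sim A_\infty\overline F(x)+C_\infty\overline G(x),\qquad C_\infty=\frac{\mathrm E S_{\infty,+}^\alpha}{\mu_\alpha(1-\mu_\alpha)} .$$ -/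

import Mathlib

open MeasureTheory ProbabilityTheory Filter Topology Asymptotics

/-- The tail `U(x, ∞)` of a distribution `U` on the real line. -/
noncomputable def tail (U : Measure ℝ) (x : ℝ) : ℝ := U.real (Set.Ioi x)

/-- The distribution on `[0, ∞)` with distribution function `V(x) 1_{x ≥ 0}`,
that is, the law of `max ζ 0` when `ζ` has law `V`. -/
noncomputable def posPartLaw (V : Measure ℝ) : Measure ℝ := V.map (fun x => max x 0)

/-- Convolution equivalence with index `α` of a distribution `V` on `[0, ∞)`. -/
structure ConvEquivNonneg (α : ℝ) (V : Measure ℝ) : Prop where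
  tail_pos : ∀ x, 0 < tail V x
  long_tail : ∀ y : ℝ,
    Tendsto (fun x => tail V (x - y) / tail V x) atTop (𝓝 (Real.exp (α * y)))
  conv_tail : ∃ c : ℝ,
    Tendsto (fun x => tail (V.conv V) x / tail V x) atTop (𝓝 (2 * c))

/-- The class `𝒮(α)`: a distribution `V` on `ℝ` is convolution equivalent if the distribution
`V(x) 1_{x ≥ 0}` on `[0, ∞)` is. -/
def ConvEquiv (α : ℝ) (V : Measure ℝ) : Prop := 0 ≤ α ∧ ConvEquivNonneg α (posPartLaw V)

/-- The conditional law of `ln ξ` given `ξ > 0` when `ξ` has law `U`; its distribution function is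
`x ↦ 1 - U(eˣ, ∞) / U(0, ∞)` (see `logLaw_Iic`). -/
noncomputable def logLaw (U : Measure ℝ) : Measure ℝ := (U[|Set.Ioi (0 : ℝ)]).map Real.log

theorem logLaw_Iic (U : Measure ℝ) [IsProbabilityMeasure U] (h : 0 < tail U 0) (x : ℝ) :
    (logLaw U).real (Set.Iic x) = 1 - tail U (Real.exp x) / tail U 0 := by
  have hU : U (Set.Ioi 0) ≠ 0 := by
    intro h0
    simp [tail, measureReal_def, h0] at h
  have : IsProbabilityMeasure (U[|Set.Ioi (0 : ℝ)]) := cond_isProbabilityMeasure hU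
  have : IsProbabilityMeasure (logLaw U) :=
    Measure.isProbabilityMeasure_map Real.measurable_log.aemeasurable
  have h1 : (logLaw U).real (Set.Ioi x) = tail U (Real.exp x) / tail U 0 := by
    unfold logLaw tail
    rw [map_measureReal_apply Real.measurable_log measurableSet_Ioi,
      measureReal_def, cond_apply measurableSet_Ioi, ENNReal.toReal_mul, ENNReal.toReal_inv]
    have : Set.Ioi (0 : ℝ) ∩ Real.log ⁻¹' Set.Ioi x = Set.Ioi (Real.exp x) := by
      ext z
      simp only [Set.mem_inter_iff, Set.mem_Ioi, Set.mem_preimage]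
      constructor
      · rintro ⟨hz, hx⟩
        exact (Real.lt_log_iff_exp_lt hz).1 hx
      · intro hz
        have h0 : 0 < z := (Real.exp_pos x).trans hz
        exact ⟨h0, (Real.lt_log_iff_exp_lt h0).2 hz⟩
    rw [this, div_eq_inv_mul, measureReal_def, measureReal_def]
  rw [← h1, ← Set.compl_Ioi, probReal_compl_eq_one_sub measurableSet_Ioi]

/-- The class `ℛ*_{-α}`: strongly regular variation with index `α`. -/
def StronglyRegVar (α : ℝ) (U : Measure ℝ) : Prop := ConvEquiv α (logLaw U)

/-- The convex combination `p F + (1 - p) G`. -/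
noncomputable def convexComb (p : ℝ) (F G : Measure ℝ) : Measure ℝ :=
  ENNReal.ofReal p • F + ENNReal.ofReal (1 - p) • G

/-- `z_+ ^ α`, with the convention that it vanishes for `z ≤ 0`, also if `α = 0`. -/
noncomputable def posPow (α z : ℝ) : ℝ := if 0 < z then z ^ α else 0

/-- `μ_α = E Y ^ α`, where `Y` has law `G` on `(0, ∞)`. -/
noncomputable def moment_G (α : ℝ) (G : Measure ℝ) : ℝ := ∫ y, y ^ α ∂G

section Model

variable {Ω : Type*}

/-- `S_n = ∑_{i=1}^n X_i ∏_{j=1}^i Y_j`; here `X i`, `Y i` stand for `X_{i+1}`, `Y_{i+1}`. -/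
def S (X Y : ℕ → Ω → ℝ) (n : ℕ) (ω : Ω) : ℝ :=
  ∑ i ∈ Finset.range n, X i ω * ∏ j ∈ Finset.range (i + 1), Y j ω

/-- `M_n = max_{0 ≤ k ≤ n} S_k`. -/
noncomputable def M (X Y : ℕ → Ω → ℝ) (n : ℕ) (ω : Ω) : ℝ :=
  (Finset.range (n + 1)).sup' Finset.nonempty_range_add_one (fun k => S X Y k ω)

/-- `S_∞`, the limit of `S_n`. -/
noncomputable def Sinf (X Y : ℕ → Ω → ℝ) (ω : Ω) : ℝ := limUnder atTop (fun n => S X Y n ω)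

/-- `M_∞`, the limit of `M_n`. -/
noncomputable def Minf (X Y : ℕ → Ω → ℝ) (ω : Ω) : ℝ := limUnder atTop (fun n => M X Y n ω)

/-- `A_n = ∑_{i=1}^n μ ^ i`. -/
noncomputable def coeffA (μ : ℝ) (n : ℕ) : ℝ := ∑ i ∈ Finset.Icc 1 n, μ ^ i

/-- `∑_{i=1}^n μ ^ (i-2) E (Z_{n-i+1})_+ ^ α`. With `Z = M` this is `B_n`, with `Z = S` it
is `C_n`. -/
noncomputable def coeffBC [MeasurableSpace Ω] (P : Measure Ω) (α μ : ℝ) (Z : ℕ → Ω → ℝ) (n : ℕ) :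
    ℝ :=
  ∑ i ∈ Finset.Icc 1 n, μ ^ ((i : ℤ) - 2) * ∫ ω, posPow α (Z (n - i + 1) ω) ∂P

/-- `A_∞ = μ / (1 - μ)`. -/
noncomputable def coeffAinf (μ : ℝ) : ℝ := μ / (1 - μ)

/-- `E Z_+ ^ α / (μ (1 - μ))`. With `Z = M_∞` this is `B_∞`, with `Z = S_∞` it is `C_∞`. -/
noncomputable def coeffBCinf [MeasurableSpace Ω] (P : Measure Ω) (α μ : ℝ) (Z : Ω → ℝ) : ℝ :=
  (∫ ω, posPow α (Z ω) ∂P) / (μ * (1 - μ))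

end Model

/-!
Write `f = tail F`, `g = tail G` and `h = f + g`. Every error term is measured relative to `h`,
because the hypothesis says something about mixtures of `F` and `G` only: `h` is regularly varying
with index `-α`, whereas `f` and `g` are so up to `o(h)`, being linear combinations of the tails of
two different mixtures.

The one deep ingredient concerns a single convolution equivalent law `V` (on the logarithmic scale):
the limit of `tail (V * V) / tail V`, which is only assumed to exist, equals `2 ∫ exp (α y) dV`
(`conv_tail_const_le`). Otherwise some mass would be lost at infinity, and this is tested with the
weights `exp (α x + ε min x T)`. They are submultiplicative, so a weight with excess `η` over
`m = ∫ exp (α y) dV` has excess at most `2 m η + η ^ 2` over `m ^ 2` under `V * V`, while comparing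
tails gives about `2 c η`. The choice of `T` for which the excess is exactly `η` is possible because
exponential moments of order larger than `α` are infinite. In consequence, two independent factors
with a large product are both large only with a negligible probability (`RegPair.negl`).

It follows that a large sum `X + Z` is due to one of its terms, and a large product `Y * Z` to one
of its factors, the other one entering through its moment of order `α`. Both facts are stated as
`TailWithin`, which says that a tail is `a f + b g` up to `u h` asymptotically; one step
`Z ↦ Y * (X + Z)` maps `(a, b, u)` to `(μ (1 + a), μ b + E (X + Z)_+ ^ α, μ u)` with `μ = E Y ^ α`
(`RegPair.tailWithin_step`). The laws of `S n` arise by iterating this step, and so do those of `M n`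
as far as `[0, ∞)` is concerned, which gives the finite-time statement.

For `μ < 1` a version of the step that is uniform in the law of `Z` bounds the tails of all `M n` by
one multiple of `h` (`RegPair.exists_uniform_tail_bound`). So `M n` is almost surely bounded, and the
laws of both limits have tails `O(h)` and are preserved by the step; since the step multiplies the
error by `μ`, the tails are those predicted by the fixed point of `(a, b) ↦ (μ (1 + a), μ b + …)`
(`RegPair.tailWithin_fixedPoint`). Convergence of `S n` is by Borel–Cantelli.
-/


/-! ### Tails and stochastic comparison -/

theorem tail_nonneg (U : Measure ℝ) (x : ℝ) : 0 ≤ tail U x := measureReal_nonneg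

theorem tail_antitone (U : Measure ℝ) [IsFiniteMeasure U] : Antitone (tail U) :=
  fun _ _ h => measureReal_mono (Set.Ioi_subset_Ioi h)

theorem tail_measurable (U : Measure ℝ) [IsFiniteMeasure U] : Measurable (tail U) :=
  (tail_antitone U).measurable

theorem tail_le_one (U : Measure ℝ) [IsProbabilityMeasure U] (x : ℝ) : tail U x ≤ 1 :=
  measureReal_le_one

theorem tail_tendsto_zero (U : Measure ℝ) [IsFiniteMeasure U] :
    Tendsto (tail U) atTop (𝓝 0) := by
  have h := tendsto_measure_iInter_atTop (μ := U) (s := fun x : ℝ => Set.Ioi x)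
    (fun _ => measurableSet_Ioi.nullMeasurableSet) (fun _ _ h => Set.Ioi_subset_Ioi h)
    ⟨0, measure_ne_top _ _⟩
  have h0 : ⋂ x : ℝ, Set.Ioi x = ∅ := by
    ext y
    simp only [Set.mem_iInter, Set.mem_Ioi, Set.mem_empty_iff_false, iff_false, not_forall]
    exact ⟨y, lt_irrefl y⟩
  rw [h0, measure_empty] at h
  have := (ENNReal.tendsto_toReal ENNReal.zero_ne_top).comp h
  exact this

theorem ofReal_tail (U : Measure ℝ) [IsFiniteMeasure U] (x : ℝ) :
    ENNReal.ofReal (tail U x) = U (Set.Ioi x) := by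
  simp [tail, measureReal_def]

theorem eq_empty_or_Ioi_of_isOpen_isUpperSet {A : Set ℝ} {a : ℝ} (ho : IsOpen A)
    (hu : IsUpperSet A) (ha : A ⊆ Set.Ioi a) : A = ∅ ∨ ∃ s, a ≤ s ∧ A = Set.Ioi s := by
  rcases A.eq_empty_or_nonempty with h | h
  · exact Or.inl h
  · have hb : BddBelow A := ⟨a, fun x hx => (ha hx).le⟩
    refine Or.inr ⟨sInf A, le_csInf h fun x hx => (ha hx).le, ?_⟩
    have hs : sInf A ∉ A := by
      intro hs
      obtain ⟨l, hl, hl'⟩ := exists_Ioc_subset_of_mem_nhds (ho.mem_nhds hs) ⟨sInf A - 1, by simp⟩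
      have h1 : (l + sInf A) / 2 ∈ A := hl' ⟨by linarith, by linarith⟩
      have := csInf_le hb h1
      linarith
    ext x
    constructor
    · intro hx
      exact lt_of_le_of_ne (csInf_le hb hx) fun h => hs (h ▸ hx)
    · intro hx
      obtain ⟨y, hy, hyx⟩ := exists_lt_of_csInf_lt h hx
      exact hu hyx.le hy

/-- A comparison of tails beyond `a` passes to integrals of increasing functions that vanish up to
`a`: their superlevel sets are half-lines beyond `a`. -/
theorem lintegral_le_of_tail_le {U V : Measure ℝ} {κ : ENNReal} {a : ℝ}
    (h : ∀ x, a ≤ x → U (Set.Ioi x) ≤ κ * V (Set.Ioi x)) {g : ℝ → ℝ} (hg : Monotone g)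
    (hgo : ∀ t, 0 ≤ t → IsOpen {x | t < g x}) (hg0 : ∀ x, x ≤ a → g x ≤ 0) :
    ∫⁻ x, ENNReal.ofReal (g x) ∂U ≤ κ * ∫⁻ x, ENNReal.ofReal (g x) ∂V := by
  have hm : Measurable fun x => max (g x) 0 := hg.measurable.max measurable_const
  have key : ∀ W : Measure ℝ, ∫⁻ x, ENNReal.ofReal (g x) ∂W
      = ∫⁻ t in Set.Ioi 0, W {x | t < g x} := by
    intro W
    have h1 : ∀ x, ENNReal.ofReal (g x) = ENNReal.ofReal (max (g x) 0) := fun x => by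
      simp [ENNReal.ofReal_max]
    simp_rw [h1]
    rw [lintegral_eq_lintegral_meas_lt W (f := fun x => max (g x) 0)
      (ae_of_all _ fun x => le_max_right _ _) hm.aemeasurable]
    refine setLIntegral_congr_fun measurableSet_Ioi fun t ht => ?_
    simp only [Set.mem_Ioi] at ht
    congr 1
    ext x
    simp [ht.not_gt]
  have hmeas : Measurable fun t => V {x | t < g x} := by
    apply Antitone.measurable
    exact fun s t hst => measure_mono fun x (hx : t < g x) => lt_of_le_of_lt hst hx
  rw [key U, key V, ← lintegral_const_mul κ hmeas]
  refine setLIntegral_mono (hmeas.const_mul κ) fun t ht => ?_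
  have ht : 0 < t := ht
  rcases eq_empty_or_Ioi_of_isOpen_isUpperSet (hgo t ht.le)
    (fun x y hxy (hx : t < g x) => lt_of_lt_of_le hx (hg hxy))
    (a := a) (fun x (hx : t < g x) => by
      by_contra hc
      have := hg0 x (not_lt.1 hc)
      linarith) with h0 | ⟨s, hs, h0⟩
  · simp [h0]
  · rw [h0]
    exact h s hs

/-! ### Convolution equivalence: the constant in the definition -/

section Additive

variable {α : ℝ} {V : Measure ℝ} [IsProbabilityMeasure V]

/-- The event that two summands both exceed `K` and their sum exceeds `x` is what is left of
`{a + b > x}` once one of the summands is at most `K`. -/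
theorem tail_conv_eq {K x : ℝ} (hx : 2 * K < x) :
    tail (V.conv V) x = 2 * ∫ y in Set.Iic K, tail V (x - y) ∂V
      + (V.prod V).real {p | K < p.1 ∧ K < p.2 ∧ x < p.1 + p.2} := by
  have hms : MeasurableSet {p : ℝ × ℝ | x < p.1 + p.2} :=
    measurableSet_lt measurable_const (measurable_fst.add measurable_snd)
  have hA : MeasurableSet {p : ℝ × ℝ | p.1 ≤ K ∧ x < p.1 + p.2} :=
    (measurableSet_le measurable_fst measurable_const).inter hms
  have hB : MeasurableSet {p : ℝ × ℝ | p.2 ≤ K ∧ x < p.1 + p.2} :=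
    (measurableSet_le measurable_snd measurable_const).inter hms
  have hC : MeasurableSet {p : ℝ × ℝ | K < p.1 ∧ K < p.2 ∧ x < p.1 + p.2} :=
    (measurableSet_lt measurable_const measurable_fst).inter
      ((measurableSet_lt measurable_const measurable_snd).inter hms)
  have h1 : tail (V.conv V) x = (V.prod V).real {p | x < p.1 + p.2} := by
    unfold tail Measure.conv
    rw [map_measureReal_apply (by fun_prop) measurableSet_Ioi]
    rfl
  have h2 : {p : ℝ × ℝ | x < p.1 + p.2} = ({p | p.1 ≤ K ∧ x < p.1 + p.2} ∪
      {p | p.2 ≤ K ∧ x < p.1 + p.2}) ∪ {p | K < p.1 ∧ K < p.2 ∧ x < p.1 + p.2} := by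
    ext p
    simp only [Set.mem_ofPred_eq, Set.mem_union]
    rcases le_or_gt p.1 K with h | h <;> rcases le_or_gt p.2 K with h' | h' <;> grind
  have hint : Integrable (fun y => tail V (x - y)) V :=
    Integrable.of_bound ((tail_measurable V).comp
      (measurable_const.sub measurable_id)).aestronglyMeasurable 1
      (ae_of_all _ fun y => by
        rw [Real.norm_of_nonneg (tail_nonneg _ _)]; exact tail_le_one _ _)
  have hAv : (V.prod V).real {p | p.1 ≤ K ∧ x < p.1 + p.2}
      = ∫ y in Set.Iic K, tail V (x - y) ∂V := by
    rw [← ENNReal.toReal_ofReal (integral_nonneg fun y => tail_nonneg _ _), measureReal_def,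
      ofReal_integral_eq_lintegral_ofReal hint.integrableOn (ae_of_all _ fun y => tail_nonneg _ _),
      Measure.prod_apply hA, ← lintegral_indicator measurableSet_Iic]
    congr 1
    refine lintegral_congr fun y => ?_
    by_cases hy : y ≤ K
    · rw [Set.indicator_of_mem (Set.mem_Iic.2 hy), ofReal_tail]
      congr 1
      ext z
      simp [hy, sub_lt_iff_lt_add']
    · rw [Set.indicator_of_notMem (by simpa using hy)]
      simp [hy]
  have hBv : (V.prod V).real {p | p.2 ≤ K ∧ x < p.1 + p.2}
      = (V.prod V).real {p | p.1 ≤ K ∧ x < p.1 + p.2} := by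
    conv_lhs => rw [← Measure.prod_swap]
    rw [map_measureReal_apply measurable_swap hB]
    congr 1
    ext p
    simp [add_comm]
  rw [h1, h2, measureReal_union _ hC, measureReal_union _ hB, hBv, hAv]
  · ring
  · rw [Set.disjoint_left]
    rintro p ⟨h, h'⟩ ⟨h3, -⟩
    linarith
  · rw [Set.disjoint_left]
    rintro p (⟨h, -⟩ | ⟨h, -⟩) ⟨h3, h4, -⟩ <;> linarith

theorem tendsto_setIntegral_tail_sub (hV : ConvEquivNonneg α V) (K : ℝ) :
    Tendsto (fun x => (∫ y in Set.Iic K, tail V (x - y) ∂V) / tail V x) atTop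
      (𝓝 (∫ y in Set.Iic K, Real.exp (α * y) ∂V)) := by
  have hm : ∀ x, Measurable fun y => tail V (x - y) / tail V x := fun x =>
    ((tail_measurable V).comp (measurable_const.sub measurable_id)).div_const _
  simp_rw [← integral_div]
  refine tendsto_integral_filter_of_dominated_convergence (fun _ => Real.exp (α * K) + 1)
    (Eventually.of_forall fun x => (hm x).aestronglyMeasurable) ?_ (integrable_const _)
    (ae_of_all _ fun y => hV.long_tail y)
  filter_upwards [(hV.long_tail K).eventually_le_const (lt_add_one _)] with x hx
  filter_upwards [ae_restrict_mem measurableSet_Iic] with y hy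
  rw [Real.norm_of_nonneg (div_nonneg (tail_nonneg _ _) (tail_nonneg _ _))]
  refine le_trans (div_le_div_of_nonneg_right (tail_antitone V ?_) (tail_nonneg _ _)) hx
  have : y ≤ K := hy
  linarith

theorem tendsto_prod_Ioi_div_tail (hV : ConvEquivNonneg α V) {c : ℝ}
    (hc : Tendsto (fun x => tail (V.conv V) x / tail V x) atTop (𝓝 (2 * c))) (K : ℝ) :
    Tendsto (fun x => (V.prod V).real {p | K < p.1 ∧ K < p.2 ∧ x < p.1 + p.2} / tail V x) atTop
      (𝓝 (2 * c - 2 * ∫ y in Set.Iic K, Real.exp (α * y) ∂V)) := by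
  refine (hc.sub ((tendsto_setIntegral_tail_sub hV K).const_mul 2)).congr' ?_
  filter_upwards [eventually_gt_atTop (2 * K)] with x hx
  rw [tail_conv_eq hx]
  ring

theorem setIntegral_exp_le (hV : ConvEquivNonneg α V) {c : ℝ}
    (hc : Tendsto (fun x => tail (V.conv V) x / tail V x) atTop (𝓝 (2 * c))) (K : ℝ) :
    ∫ y in Set.Iic K, Real.exp (α * y) ∂V ≤ c := by
  have := ge_of_tendsto' (tendsto_prod_Ioi_div_tail hV hc K)
    (fun x => div_nonneg measureReal_nonneg (tail_nonneg _ _))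
  linarith

theorem integrable_exp (hα : 0 ≤ α) (hV : ConvEquivNonneg α V) :
    Integrable (fun y => Real.exp (α * y)) V := by
  obtain ⟨c, hc⟩ := hV.conv_tail
  have hm : Measurable fun y : ℝ => Real.exp (α * y) := by fun_prop
  refine (aecover_Iic (μ := V) tendsto_id).integrable_of_integral_norm_bounded c (fun K => ?_)
    (Eventually.of_forall fun K => ?_)
  · refine Measure.integrableOn_of_bounded (M := Real.exp (α * K)) (measure_ne_top _ _)
      hm.aestronglyMeasurable ?_
    filter_upwards [ae_restrict_mem measurableSet_Iic] with y hy
    rw [Real.norm_of_nonneg (Real.exp_pos _).le]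
    exact Real.exp_le_exp.2 (mul_le_mul_of_nonneg_left hy hα)
  · simp_rw [Real.norm_of_nonneg (Real.exp_pos _).le]
    exact setIntegral_exp_le hV hc K

/-- The weight whose integral tests the constant: an exponential moment of order slightly above
`α`, truncated so that it stays finite. -/
noncomputable def tiltedExcess (α ε T x : ℝ) : ℝ :=
  Real.exp (α * x) * (Real.exp (ε * min (max x 0) T) - 1)

theorem tiltedExcess_nonneg {ε T : ℝ} (hε : 0 ≤ ε) (hT : 0 ≤ T) (x : ℝ) :
    0 ≤ tiltedExcess α ε T x := by
  unfold tiltedExcess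
  refine mul_nonneg (Real.exp_pos _).le (sub_nonneg.2 (Real.one_le_exp ?_))
  positivity

theorem tiltedExcess_monotone {ε T : ℝ} (hα : 0 ≤ α) (hε : 0 ≤ ε) (hT : 0 ≤ T) :
    Monotone (tiltedExcess α ε T) := by
  intro x y hxy
  unfold tiltedExcess
  refine mul_le_mul (Real.exp_le_exp.2 (mul_le_mul_of_nonneg_left hxy hα)) ?_
    (sub_nonneg.2 (Real.one_le_exp (by positivity))) (Real.exp_pos _).le
  gcongr

/-- Truncation keeps the exponential weight submultiplicative. -/
theorem exp_add_tiltedExcess_le {ε T : ℝ} (hε : 0 ≤ ε) (hT : 0 ≤ T) (a b : ℝ) :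
    Real.exp (α * (a + b)) + tiltedExcess α ε T (a + b) ≤
      (Real.exp (α * a) + tiltedExcess α ε T a) * (Real.exp (α * b) + tiltedExcess α ε T b) := by
  have h : ∀ x, Real.exp (α * x) + tiltedExcess α ε T x
      = Real.exp (α * x + ε * min (max x 0) T) := fun x => by
    unfold tiltedExcess
    rw [Real.exp_add]
    ring
  rw [h, h, h, ← Real.exp_add]
  apply Real.exp_le_exp.2
  have h1 : max (a + b) 0 ≤ max a 0 + max b 0 := by
    apply max_le <;> linarith [le_max_left a 0, le_max_left b 0, le_max_right a 0, le_max_right b 0]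
  have h2 : min (max (a + b) 0) T ≤ min (max a 0) T + min (max b 0) T := by
    have ha := le_max_right a 0
    have hb := le_max_right b 0
    rcases min_choice (max a 0) T with h3 | h3 <;> rcases min_choice (max b 0) T with h4 | h4 <;>
      rw [h3, h4]
    · exact (min_le_left _ _).trans h1
    · exact (min_le_right _ _).trans (by linarith)
    · exact (min_le_right _ _).trans (by linarith)
    · exact (min_le_right _ _).trans (by linarith)
  nlinarith [mul_le_mul_of_nonneg_left h2 hε]

theorem integrable_tiltedExcess {ε T : ℝ} (hα : 0 ≤ α) (hV : ConvEquivNonneg α V) (hε : 0 ≤ ε)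
    (hT : 0 ≤ T) : Integrable (tiltedExcess α ε T) V := by
  have hm : Measurable (tiltedExcess α ε T) := (tiltedExcess_monotone hα hε hT).measurable
  refine ((integrable_exp hα hV).mul_const (Real.exp (ε * T))).mono' hm.aestronglyMeasurable
    (ae_of_all _ fun x => ?_)
  rw [Real.norm_of_nonneg (tiltedExcess_nonneg hε hT x)]
  unfold tiltedExcess
  refine mul_le_mul_of_nonneg_left ?_ (Real.exp_pos _).le
  have : Real.exp (ε * min (max x 0) T) ≤ Real.exp (ε * T) :=
    Real.exp_le_exp.2 (mul_le_mul_of_nonneg_left (min_le_right _ _) hε)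
  linarith

/-- Since the tail decays no faster than `exp (-(α + δ) x)` for each `δ > 0`, exponential moments of
order above `α` are infinite; hence, as the truncation level runs, the integral of the weight
takes every positive value. -/
theorem exists_integral_tiltedExcess_eq (hα : 0 ≤ α) (hV : ConvEquivNonneg α V) {ε η : ℝ}
    (hε : 0 < ε) (hη : 0 < η) :
    ∃ T, 0 ≤ T ∧ ∫ x, tiltedExcess α ε T x ∂V = η := by
  set φ : ℝ → ℝ := fun T => ∫ x, tiltedExcess α ε T x ∂V with hφ
  have hcont : ∀ B, 0 ≤ B → ContinuousOn φ (Set.Icc 0 B) := by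
    intro B hB
    refine continuousOn_of_dominated (bound := tiltedExcess α ε B)
      (fun T hT => (integrable_tiltedExcess hα hV hε.le hT.1).aestronglyMeasurable) ?_
      (integrable_tiltedExcess hα hV hε.le hB) ?_
    · refine fun T hT => ae_of_all _ fun x => ?_
      rw [Real.norm_of_nonneg (tiltedExcess_nonneg hε.le hT.1 x)]
      unfold tiltedExcess
      have := hT.2
      gcongr
    · refine ae_of_all _ fun x => Continuous.continuousOn ?_
      unfold tiltedExcess
      fun_prop
  -- the products `exp ((α + ε) n) * tail V n` grow geometrically
  have hgrow : Tendsto (fun n : ℕ => Real.exp ((α + ε) * n) * tail V n) atTop atTop := by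
    have hlim : Tendsto (fun x => tail V (x + 1) / tail V x) atTop (𝓝 (Real.exp (-α))) := by
      simpa using hV.long_tail (-1)
    have hlt : Real.exp (-(α + ε / 2)) < Real.exp (-α) := Real.exp_lt_exp.2 (by linarith)
    obtain ⟨N, hN⟩ := eventually_atTop.1
      (tendsto_natCast_atTop_atTop.eventually (hlim.eventually_const_le hlt))
    refine (tendsto_add_atTop_iff_nat N).1 (tendsto_atTop_of_geom_le
      (c := Real.exp (ε / 2)) (mul_pos (Real.exp_pos _) (hV.tail_pos _))
      (Real.one_lt_exp_iff.2 (by linarith)) fun n => ?_)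
    have h1 := hN (n + N) (by omega)
    rw [le_div_iff₀ (hV.tail_pos _)] at h1
    push_cast at h1 ⊢
    have h2 : Real.exp ((α + ε) * (n + 1 + N)) = Real.exp (ε / 2) * Real.exp ((α + ε) * (n + N)) *
        Real.exp (α + ε / 2) := by
      rw [← Real.exp_add, ← Real.exp_add]
      ring_nf
    have h3 : Real.exp (α + ε / 2) * Real.exp (-(α + ε / 2)) = 1 := by
      rw [← Real.exp_add]; simp
    rw [show (n : ℝ) + 1 + N = n + N + 1 by ring] at h2 ⊢
    rw [h2]
    calc Real.exp (ε / 2) * (Real.exp ((α + ε) * (n + N)) * tail V (n + N))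
        = Real.exp (ε / 2) * Real.exp ((α + ε) * (n + N)) * Real.exp (α + ε / 2) *
          (Real.exp (-(α + ε / 2)) * tail V (n + N)) := by
          linear_combination (- Real.exp (ε / 2) * Real.exp ((α + ε) * (n + N)) * tail V (n + N)) * h3
      _ ≤ _ := by gcongr
  obtain ⟨n, hn⟩ := (hgrow.eventually_ge_atTop (η + ∫ y, Real.exp (α * y) ∂V)).exists
  have hbig : η ≤ φ n := by
    have h1 : Real.exp ((α + ε) * n) * tail V n ≤
        ∫ x, (tiltedExcess α ε n x + Real.exp (α * x)) ∂V := by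
      have h2 : Real.exp ((α + ε) * n) * tail V n
          = ∫ x in Set.Ioi (n : ℝ), Real.exp ((α + ε) * n) ∂V := by
        simp [tail, mul_comm]
      have hi := (integrable_tiltedExcess hα hV hε.le (Nat.cast_nonneg n)).add (integrable_exp hα hV)
      rw [h2]
      refine le_trans (setIntegral_mono_on (integrable_const _).integrableOn hi.integrableOn
        measurableSet_Ioi fun x hx => ?_) (setIntegral_le_integral hi (ae_of_all _ fun x =>
          add_nonneg (tiltedExcess_nonneg hε.le (Nat.cast_nonneg n) x) (Real.exp_pos _).le))
      have hx : (n : ℝ) < x := hx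
      have hx0 : 0 ≤ x := (Nat.cast_nonneg n).trans hx.le
      simp only [Pi.add_apply, tiltedExcess]
      rw [max_eq_left hx0, min_eq_right hx.le, mul_sub, mul_one, sub_add_cancel, ← Real.exp_add]
      apply Real.exp_le_exp.2
      nlinarith
    rw [integral_add (integrable_tiltedExcess hα hV hε.le (Nat.cast_nonneg n))
      (integrable_exp hα hV)] at h1
    linarith
  have h0 : φ 0 = 0 := by
    simp [hφ, tiltedExcess]
  obtain ⟨T, hT, hTη⟩ := intermediate_value_Icc (Nat.cast_nonneg n) (hcont n (Nat.cast_nonneg n))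
    ⟨h0.le.trans hη.le, hbig⟩
  exact ⟨T, hT.1, hTη⟩

/-- The limit of `tail (V * V) / tail V` is twice the exponential moment of order `α`. If it were
larger, then a submultiplicative weight with excess moment `η` would have, for `V * V`, excess
moment at most `2 m η + η ^ 2` by submultiplicativity, but about `2 c η` by the comparison of
tails. -/
theorem conv_tail_const_le (hα : 0 ≤ α) (hV : ConvEquivNonneg α V) {c : ℝ}
    (hc : Tendsto (fun x => tail (V.conv V) x / tail V x) atTop (𝓝 (2 * c))) :
    c ≤ ∫ y, Real.exp (α * y) ∂V := by
  set m := ∫ y, Real.exp (α * y) ∂V with hm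
  have hm0 : 0 ≤ m := integral_nonneg fun y => (Real.exp_pos _).le
  by_contra! hcm
  obtain ⟨c', hc1, hc2⟩ := exists_between hcm
  obtain ⟨x₀, hx₀⟩ := eventually_atTop.1
    (hc.eventually_const_le (show 2 * c' < 2 * c by linarith))
  set η := c' - m with hη
  have hη0 : 0 < η := by linarith
  obtain ⟨ε, hε, hεη⟩ : ∃ ε, 0 < ε ∧
      2 * c' * (Real.exp (α * x₀) * (Real.exp (ε * max x₀ 0) - 1)) < η ^ 2 := by
    have h1 : Tendsto (fun ε => 2 * c' * (Real.exp (α * x₀) * (Real.exp (ε * max x₀ 0) - 1)))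
        (𝓝[>] 0) (𝓝 (2 * c' * (Real.exp (α * x₀) * (Real.exp (0 * max x₀ 0) - 1)))) :=
      tendsto_nhdsWithin_of_tendsto_nhds (Continuous.tendsto (by fun_prop) _)
    have h2 := h1.eventually_lt_const (u := η ^ 2) (by simp; positivity)
    obtain ⟨ε, h3, h4⟩ := (h2.and self_mem_nhdsWithin).exists
    exact ⟨ε, h4, h3⟩
  obtain ⟨T, hT, hTη⟩ := exists_integral_tiltedExcess_eq hα hV hε hη0
  set g := tiltedExcess α ε T with hg
  have hgm : Monotone g := tiltedExcess_monotone hα hε.le hT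
  have hg0 : ∀ x, 0 ≤ g x := tiltedExcess_nonneg hε.le hT
  have hgc : Continuous g := by
    rw [hg]; unfold tiltedExcess; fun_prop
  have hgi : Integrable g V := integrable_tiltedExcess hα hV hε.le hT
  have hei := integrable_exp hα hV
  have hgx : 2 * c' * g x₀ < η ^ 2 := by
    refine lt_of_le_of_lt ?_ hεη
    have hc0 : 0 ≤ c' := by linarith
    rw [hg]; unfold tiltedExcess
    gcongr
    exact min_le_left _ _
  -- integrals of the weight with respect to the convolution
  have hprod : Integrable (fun p : ℝ × ℝ => (Real.exp (α * p.1) + g p.1) *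
      (Real.exp (α * p.2) + g p.2)) (V.prod V) := (hei.add hgi).mul_prod (hei.add hgi)
  have hgsum : Integrable (fun p : ℝ × ℝ => g (p.1 + p.2)) (V.prod V) := by
    refine hprod.mono' (hgc.comp (by fun_prop)).aestronglyMeasurable (ae_of_all _ fun p => ?_)
    rw [Real.norm_of_nonneg (hg0 _)]
    exact (le_add_of_nonneg_left (Real.exp_pos _).le).trans
      (exp_add_tiltedExcess_le hε.le hT p.1 p.2)
  have hesum : Integrable (fun p : ℝ × ℝ => Real.exp (α * (p.1 + p.2))) (V.prod V) := by
    simp_rw [mul_add, Real.exp_add]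
    exact hei.mul_prod hei
  have hupper : m ^ 2 + ∫ p, g (p.1 + p.2) ∂(V.prod V) ≤ (m + η) ^ 2 := by
    have h1 := integral_mono (hesum.add hgsum) hprod
      (fun p => exp_add_tiltedExcess_le hε.le hT p.1 p.2)
    rw [integral_prod_mul (fun x => Real.exp (α * x) + g x) (fun x => Real.exp (α * x) + g x),
      integral_add hei hgi, hTη, ← hm] at h1
    have h2 := integral_add hesum hgsum
    simp only [Pi.add_apply] at h1 h2
    rw [h2] at h1
    simp_rw [mul_add, Real.exp_add] at h1
    rw [integral_prod_mul (fun x => Real.exp (α * x)) (fun x => Real.exp (α * x)), ← hm] at h1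
    nlinarith
  have hlower : 2 * c' * (η - g x₀) ≤ ∫ p, g (p.1 + p.2) ∂(V.prod V) := by
    have hc0 : 0 ≤ 2 * c' := by linarith
    have hcomp := lintegral_le_of_tail_le (U := V) (V := V.conv V) (κ := (ENNReal.ofReal (2 * c'))⁻¹)
      (a := x₀) (g := fun x => g x - g x₀) (fun x hx => ?_)
      (fun x y hxy => sub_le_sub_right (hgm hxy) _)
      (fun t _ => isOpen_lt continuous_const (hgc.sub continuous_const))
      (fun x hx => sub_nonpos.2 (hgm hx))
    · have hc1 : 0 < 2 * c' := by linarith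
      have h1 : ENNReal.ofReal (2 * c') * ∫⁻ x, ENNReal.ofReal (g x - g x₀) ∂V
          ≤ ∫⁻ x, ENNReal.ofReal (g x - g x₀) ∂(V.conv V) := by
        rwa [mul_comm, ← div_eq_mul_inv, ENNReal.le_div_iff_mul_le
          (Or.inl (by simpa using hc1)) (Or.inl ENNReal.ofReal_ne_top), mul_comm] at hcomp
      have h2 : ENNReal.ofReal (η - g x₀) ≤ ∫⁻ x, ENNReal.ofReal (g x - g x₀) ∂V := by
        have h3 : η - g x₀ = ∫ x, (g x - g x₀) ∂V := by
          rw [integral_sub hgi (integrable_const _), hTη]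
          simp
        rw [h3, integral_eq_lintegral_pos_part_sub_lintegral_neg_part
          (f := fun x => g x - g x₀) (hgi.sub (integrable_const _))]
        refine le_trans (ENNReal.ofReal_le_ofReal (sub_le_self _ ENNReal.toReal_nonneg))
          ENNReal.ofReal_toReal_le
      have h4 : ∫⁻ x, ENNReal.ofReal (g x - g x₀) ∂(V.conv V)
          ≤ ENNReal.ofReal (∫ p, g (p.1 + p.2) ∂(V.prod V)) := by
        rw [ofReal_integral_eq_lintegral_ofReal hgsum (ae_of_all _ fun p => hg0 _)]
        unfold Measure.conv
        rw [lintegral_map (by fun_prop) (by fun_prop)]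
        exact lintegral_mono fun p => ENNReal.ofReal_le_ofReal (by linarith [hg0 x₀])
      have h5 := (mul_le_mul_right h2 (ENNReal.ofReal (2 * c'))).trans (h1.trans h4)
      rw [← ENNReal.ofReal_mul hc0] at h5
      exact (ENNReal.ofReal_le_ofReal_iff (integral_nonneg fun p => hg0 _)).1 h5
    · have hc1 : 0 < 2 * c' := by linarith
      have h1 := hx₀ x hx
      rw [le_div_iff₀ (hV.tail_pos x)] at h1
      have h2 := ENNReal.ofReal_le_ofReal h1
      rw [ENNReal.ofReal_mul hc0, ofReal_tail, ofReal_tail] at h2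
      rwa [mul_comm, ← div_eq_mul_inv, ENNReal.le_div_iff_mul_le
          (Or.inl (by simpa using hc1)) (Or.inl ENNReal.ofReal_ne_top), mul_comm]
  nlinarith

/-- In a sum of two independent copies that exceeds `x`, both summands are large only with a
probability that is negligible with respect to the tail. -/
theorem exists_prod_Ioi_le (hα : 0 ≤ α) (hV : ConvEquivNonneg α V) {ε : ℝ} (hε : 0 < ε) :
    ∀ᶠ K in atTop, ∀ᶠ x in atTop,
      (V.prod V).real {p | K < p.1 ∧ K < p.2 ∧ x < p.1 + p.2} ≤ ε * tail V x := by
  obtain ⟨c, hc⟩ := hV.conv_tail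
  have h1 := (aecover_Iic (μ := V) tendsto_id).integral_tendsto_of_countably_generated
    (integrable_exp hα hV)
  have h2 := h1.eventually_const_lt
    (show (∫ y, Real.exp (α * y) ∂V) - ε / 2 < ∫ y, Real.exp (α * y) ∂V by linarith)
  filter_upwards [h2] with K hK
  have h3 := conv_tail_const_le hα hV hc
  filter_upwards [(tendsto_prod_Ioi_div_tail hV hc K).eventually_le_const (u := ε)
    (by simp only [id] at hK; linarith)] with x hx
  rwa [div_le_iff₀ (hV.tail_pos x)] at hx

end Additive

/-! ### Strong regular variation on the multiplicative scale -/

section StrongRegVar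

variable {α : ℝ} {U : Measure ℝ} [IsProbabilityMeasure U]

theorem posPow_nonneg (α z : ℝ) : 0 ≤ posPow α z := by
  unfold posPow
  split_ifs with h
  · exact Real.rpow_nonneg h.le _
  · exact le_rfl

theorem measurable_posPow (α : ℝ) : Measurable (posPow α) :=
  Measurable.ite measurableSet_Ioi (by fun_prop) measurable_const

theorem StronglyRegVar.tail_zero_pos (h : StronglyRegVar α U) : 0 < tail U 0 := by
  by_contra hc
  have h0 : U (Set.Ioi 0) = 0 := by
    have : tail U 0 = 0 := le_antisymm (not_lt.1 hc) (tail_nonneg _ _)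
    rw [← ofReal_tail, this, ENNReal.ofReal_zero]
  have h1 : logLaw U = 0 := by
    unfold logLaw
    rw [cond_eq_zero_of_meas_eq_zero h0, Measure.map_zero]
  have := h.2.tail_pos 0
  simp [posPartLaw, h1, tail] at this

theorem StronglyRegVar.cond_isProbabilityMeasure (h : StronglyRegVar α U) :
    IsProbabilityMeasure (U[|Set.Ioi (0 : ℝ)]) := by
  apply ProbabilityTheory.cond_isProbabilityMeasure
  intro h0
  have := h.tail_zero_pos
  simp [tail, measureReal_def, h0] at this

theorem posPartLaw_logLaw (U : Measure ℝ) :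
    posPartLaw (logLaw U) = (U[|Set.Ioi (0 : ℝ)]).map fun z => max (Real.log z) 0 := by
  unfold posPartLaw logLaw
  rw [Measure.map_map (by fun_prop) Real.measurable_log]
  rfl

theorem StronglyRegVar.isProbabilityMeasure (h : StronglyRegVar α U) :
    IsProbabilityMeasure (posPartLaw (logLaw U)) := by
  have := h.cond_isProbabilityMeasure
  rw [posPartLaw_logLaw]
  exact Measure.isProbabilityMeasure_map (by fun_prop)

theorem tail_posPartLaw_logLaw (U : Measure ℝ) {x : ℝ} (hx : 0 ≤ x) :
    tail (posPartLaw (logLaw U)) x = tail U (Real.exp x) / tail U 0 := by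
  unfold tail
  rw [posPartLaw_logLaw, map_measureReal_apply (by fun_prop) measurableSet_Ioi, measureReal_def,
    cond_apply measurableSet_Ioi, ENNReal.toReal_mul, ENNReal.toReal_inv, div_eq_inv_mul]
  congr 3
  ext z
  simp only [Set.mem_inter_iff, Set.mem_Ioi, Set.mem_preimage, lt_max_iff, hx.not_gt, or_false]
  constructor
  · rintro ⟨hz, h⟩
    exact (Real.lt_log_iff_exp_lt hz).1 h
  · intro hz
    have h0 : 0 < z := (Real.exp_pos x).trans hz
    exact ⟨h0, (Real.lt_log_iff_exp_lt h0).2 hz⟩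

theorem StronglyRegVar.tail_pos (h : StronglyRegVar α U) (x : ℝ) : 0 < tail U x := by
  have h1 := h.2.tail_pos (max x 0)
  rw [tail_posPartLaw_logLaw U (le_max_right _ _)] at h1
  have h2 := (div_pos_iff_of_pos_right h.tail_zero_pos).1 h1
  refine h2.trans_le (tail_antitone U ?_)
  linarith [le_max_left x 0, Real.add_one_le_exp (max x 0)]

theorem StronglyRegVar.tendsto_tail_div (h : StronglyRegVar α U) {y : ℝ} (hy : 0 < y) :
    Tendsto (fun x => tail U (x / y) / tail U x) atTop (𝓝 (y ^ α)) := by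
  have h1 := (h.2.long_tail (Real.log y)).comp Real.tendsto_log_atTop
  rw [mul_comm, ← Real.rpow_def_of_pos hy] at h1
  refine h1.congr' ?_
  filter_upwards [eventually_ge_atTop 1, eventually_ge_atTop y] with x hx hxy
  have hx0 : 0 < x := by linarith
  simp only [Function.comp_apply]
  rw [tail_posPartLaw_logLaw U (Real.log_nonneg hx), ← Real.log_div hx0.ne' hy.ne',
    tail_posPartLaw_logLaw U (Real.log_nonneg ((one_le_div hy).2 hxy)),
    Real.exp_log hx0, Real.exp_log (div_pos hx0 hy), div_div_div_cancel_right₀ h.tail_zero_pos.ne']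

theorem StronglyRegVar.isLittleO (h : StronglyRegVar α U) {y : ℝ} (hy : 0 < y) :
    (fun x => tail U (x / y) - y ^ α * tail U x) =o[atTop] tail U := by
  refine (isLittleO_iff_tendsto fun x hx => absurd hx (h.tail_pos x).ne').2 ?_
  have := (h.tendsto_tail_div hy).sub_const (y ^ α)
  rw [sub_self] at this
  refine this.congr fun x => ?_
  rw [sub_div, mul_div_cancel_right₀ _ (h.tail_pos x).ne']

theorem restrict_Ioi_le_cond : U.restrict (Set.Ioi 0) ≤ U[|Set.Ioi (0 : ℝ)] := by
  unfold ProbabilityTheory.cond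
  refine Measure.le_iff.2 fun s _ => ?_
  rw [Measure.smul_apply, smul_eq_mul]
  exact le_mul_of_one_le_left zero_le (ENNReal.one_le_inv.2 prob_le_one)

theorem StronglyRegVar.integrable_posPow (h : StronglyRegVar α U) : Integrable (posPow α) U := by
  have := h.isProbabilityMeasure
  have h1 := integrable_exp h.1 h.2
  rw [posPartLaw_logLaw, integrable_map_measure (by fun_prop) (by fun_prop)] at h1
  have h2 : Integrable (posPow α) (U.restrict (Set.Ioi 0)) := by
    refine (h1.mono_measure restrict_Ioi_le_cond).mono' (measurable_posPow α).aestronglyMeasurable ?_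
    filter_upwards [ae_restrict_mem measurableSet_Ioi] with z hz
    have hz : 0 < z := hz
    rw [Real.norm_of_nonneg (posPow_nonneg _ _), posPow, if_pos hz, Real.rpow_def_of_pos hz, mul_comm]
    exact Real.exp_le_exp.2 (mul_le_mul_of_nonneg_left (le_max_left _ _) h.1)
  have h3 : posPow α = (Set.Ioi 0).indicator (posPow α) := by
    ext z
    by_cases hz : 0 < z
    · rw [Set.indicator_of_mem (Set.mem_Ioi.2 hz)]
    · rw [Set.indicator_of_notMem (by simpa using hz), posPow, if_neg hz]
  rw [h3]
  exact (integrable_indicator_iff measurableSet_Ioi).2 h2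

theorem measurableSet_both_large (K x : ℝ) :
    MeasurableSet {p : ℝ × ℝ | K < p.1 ∧ K < p.2 ∧ x < p.1 * p.2} :=
  (measurableSet_lt measurable_const measurable_fst).inter
    ((measurableSet_lt measurable_const measurable_snd).inter
      (measurableSet_lt measurable_const (measurable_fst.mul measurable_snd)))

theorem StronglyRegVar.both_large_negligible (h : StronglyRegVar α U) {ε : ℝ} (hε : 0 < ε) :
    ∀ᶠ K in atTop, ∀ᶠ x in atTop,
      (U.prod U).real {p | K < p.1 ∧ K < p.2 ∧ x < p.1 * p.2} ≤ ε * tail U x := by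
  have := h.isProbabilityMeasure
  have := h.cond_isProbabilityMeasure
  have h0 := h.tail_zero_pos
  have h1 := exists_prod_Ioi_le h.1 h.2 (mul_pos hε h0)
  filter_upwards [Real.tendsto_log_atTop.eventually h1, eventually_ge_atTop 1] with K hK hK1
  filter_upwards [Real.tendsto_log_atTop.eventually hK, eventually_ge_atTop 1] with x hx hx1
  rw [tail_posPartLaw_logLaw U (Real.log_nonneg hx1), Real.exp_log (by linarith), mul_assoc,
    mul_div_cancel₀ _ h0.ne'] at hx
  refine le_trans ?_ hx
  have hA := measurableSet_both_large K x
  have hB : MeasurableSet {p : ℝ × ℝ | Real.log K < p.1 ∧ Real.log K < p.2 ∧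
      Real.log x < p.1 + p.2} :=
    (measurableSet_lt measurable_const measurable_fst).inter
      ((measurableSet_lt measurable_const measurable_snd).inter
        (measurableSet_lt measurable_const (measurable_fst.add measurable_snd)))
  have hφ : Measurable fun z : ℝ => max (Real.log z) 0 := by fun_prop
  rw [posPartLaw_logLaw, Measure.map_prod_map _ _ hφ hφ, map_measureReal_apply (by fun_prop) hB]
  have h2 : (U.prod U).real {p | K < p.1 ∧ K < p.2 ∧ x < p.1 * p.2}
      = ((U.restrict (Set.Ioi 0)).prod (U.restrict (Set.Ioi 0))).real
        {p | K < p.1 ∧ K < p.2 ∧ x < p.1 * p.2} := by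
    rw [Measure.prod_restrict, measureReal_restrict_apply hA, Set.inter_eq_left.2]
    rintro p ⟨h3, h4, -⟩
    exact ⟨Set.mem_Ioi.2 (by linarith), Set.mem_Ioi.2 (by linarith)⟩
  rw [h2]
  have h3 : (U.restrict (Set.Ioi 0)).prod (U.restrict (Set.Ioi 0))
      ≤ (U[|Set.Ioi (0 : ℝ)]).prod (U[|Set.Ioi (0 : ℝ)]) :=
    Measure.prod_mono restrict_Ioi_le_cond restrict_Ioi_le_cond
  refine (ENNReal.toReal_mono (measure_ne_top _ _) (h3 _)).trans (measureReal_mono ?_)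
  rintro ⟨a, b⟩ ⟨ha, hb, hab⟩
  simp only at ha hb hab
  have ha0 : 0 < a := by linarith
  have hb0 : 0 < b := by linarith
  have hla := Real.log_lt_log (by linarith) ha
  have hlb := Real.log_lt_log (by linarith) hb
  have hlab := Real.log_lt_log (by linarith) hab
  rw [Real.log_mul ha0.ne' hb0.ne'] at hlab
  have hK0 := Real.log_nonneg hK1
  simp only [Set.mem_preimage, Prod.map_apply, Set.mem_ofPred_eq]
  rw [max_eq_left (by linarith), max_eq_left (by linarith)]
  exact ⟨hla, hlb, hlab⟩

end StrongRegVar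

/-- What the argument uses of two laws all of whose convex combinations are of strongly regular
variation. Every estimate is relative to the common scale `tail F + tail G`; neither `tail F` nor
`tail G` need be regularly varying by itself. -/
structure RegPair (α : ℝ) (F G : Measure ℝ) : Prop where
  nonneg : 0 ≤ α
  pos : ∀ x, 0 < tail F x + tail G x
  regF : ∀ y, 0 < y → (fun x => tail F (x / y) - y ^ α * tail F x) =o[atTop]
    fun x => tail F x + tail G x
  regG : ∀ y, 0 < y → (fun x => tail G (x / y) - y ^ α * tail G x) =o[atTop]
    fun x => tail F x + tail G x
  intF : Integrable (posPow α) F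
  intG : Integrable (posPow α) G
  negl : ∀ ε, 0 < ε → ∀ᶠ K in atTop, ∀ᶠ x in atTop,
    ((F + G).prod (F + G)).real {p | K < p.1 ∧ K < p.2 ∧ x < p.1 * p.2}
      ≤ ε * (tail F x + tail G x)

section

variable {α : ℝ} {F G : Measure ℝ} [IsProbabilityMeasure F] [IsProbabilityMeasure G]

theorem isProbabilityMeasure_convexComb {p : ℝ} (hp : 0 < p) (hp1 : p < 1) :
    IsProbabilityMeasure (convexComb p F G) := by
  constructor
  simp only [convexComb, Measure.coe_add, Measure.coe_smul, Pi.add_apply, Pi.smul_apply,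
    measure_univ, smul_eq_mul, mul_one]
  rw [← ENNReal.ofReal_add hp.le (by linarith)]
  simp

theorem tail_convexComb {p : ℝ} (hp : 0 < p) (hp1 : p < 1) (x : ℝ) :
    tail (convexComb p F G) x = p * tail F x + (1 - p) * tail G x := by
  have h1 : (0 : ℝ) ≤ 1 - p := by linarith
  simp [tail, convexComb, measureReal_def, ENNReal.toReal_add, ENNReal.mul_ne_top,
    ENNReal.toReal_ofReal hp.le, ENNReal.toReal_ofReal h1]

/-- The tails of `F` and `G` are linear combinations of those of two different mixtures. -/
theorem regPair_of_convexComb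
    (h : ∀ p : ℝ, 0 < p → p < 1 → StronglyRegVar α (convexComb p F G)) : RegPair α F G := by
  have i2 : IsProbabilityMeasure (convexComb (1 / 2) F G) :=
    isProbabilityMeasure_convexComb (by norm_num) (by norm_num)
  have i4 : IsProbabilityMeasure (convexComb (1 / 4) F G) :=
    isProbabilityMeasure_convexComb (by norm_num) (by norm_num)
  have h2 := h (1 / 2) (by norm_num) (by norm_num)
  have h4 := h (1 / 4) (by norm_num) (by norm_num)
  have t2 : ∀ x, tail (convexComb (1 / 2) F G) x = 1 / 2 * (tail F x + tail G x) := fun x => by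
    rw [tail_convexComb (by norm_num) (by norm_num)]; ring
  have t4 : ∀ x, tail (convexComb (1 / 4) F G) x = 1 / 4 * tail F x + 3 / 4 * tail G x :=
    fun x => by rw [tail_convexComb (by norm_num) (by norm_num)]; ring
  have hpos : ∀ x, 0 < tail F x + tail G x := fun x => by
    have := h2.tail_pos x
    rw [t2] at this
    linarith
  have o2 : ∀ y, 0 < y → (fun x => 1 / 2 * (tail F (x / y) + tail G (x / y))
      - y ^ α * (1 / 2 * (tail F x + tail G x))) =o[atTop] fun x => tail F x + tail G x := by
    intro y hy
    have h0 := h2.isLittleO hy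
    simp_rw [t2] at h0
    refine h0.trans_isBigO (IsBigO.of_bound 1 (Eventually.of_forall fun x => ?_))
    rw [show (tail (convexComb (1 / 2) F G) : ℝ → ℝ) x = _ from t2 x, Real.norm_of_nonneg (hpos x).le,
      Real.norm_of_nonneg (by linarith [hpos x])]
    linarith [hpos x]
  have o4 : ∀ y, 0 < y → (fun x => (1 / 4 * tail F (x / y) + 3 / 4 * tail G (x / y))
      - y ^ α * (1 / 4 * tail F x + 3 / 4 * tail G x)) =o[atTop]
        fun x => tail F x + tail G x := by
    intro y hy
    have h0 := h4.isLittleO hy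
    simp_rw [t4] at h0
    refine h0.trans_isBigO (IsBigO.of_bound 1 (Eventually.of_forall fun x => ?_))
    have hF := tail_nonneg F x
    have hG := tail_nonneg G x
    rw [show (tail (convexComb (1 / 4) F G) : ℝ → ℝ) x = _ from t4 x, Real.norm_of_nonneg (hpos x).le,
      Real.norm_of_nonneg (by linarith)]
    linarith
  have hle : convexComb (1 / 2) F G = (2 : ENNReal)⁻¹ • (F + G) := by
    have h5 : ENNReal.ofReal (1 / 2) = 2⁻¹ := by
      rw [one_div, ENNReal.ofReal_inv_of_pos two_pos, ENNReal.ofReal_ofNat]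
    unfold convexComb
    rw [smul_add, show (1 : ℝ) - 1 / 2 = 1 / 2 by norm_num, h5]
  have hFG : F + G = (2 : ENNReal) • convexComb (1 / 2) F G := by
    rw [hle, smul_smul, ENNReal.mul_inv_cancel (by norm_num) (by norm_num), one_smul]
  have hint : Integrable (posPow α) (F + G) := by
    rw [hFG]
    exact h2.integrable_posPow.smul_measure (by norm_num)
  refine ⟨h2.1, hpos, fun y hy => ?_, fun y hy => ?_, hint.left_of_add_measure,
    hint.right_of_add_measure, fun ε hε => ?_⟩
  · refine (((o2 y hy).const_mul_left 3).sub ((o4 y hy).const_mul_left 2)).congr_left fun x => ?_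
    ring
  · refine (((o4 y hy).const_mul_left 2).sub ((o2 y hy).const_mul_left 1)).congr_left fun x => ?_
    ring
  · filter_upwards [h2.both_large_negligible (ε := ε / 2) (by linarith)] with K hK
    filter_upwards [hK] with x hx
    rw [t2] at hx
    have : ((F + G).prod (F + G)).real {p | K < p.1 ∧ K < p.2 ∧ x < p.1 * p.2} =
        4 * ((convexComb (1 / 2) F G).prod (convexComb (1 / 2) F G)).real
          {p | K < p.1 ∧ K < p.2 ∧ x < p.1 * p.2} := by
      rw [hFG, Measure.prod_smul_left, Measure.prod_smul_right, smul_smul, measureReal_ennreal_smul_apply]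
      norm_num
    rw [this]
    linarith

end

/-! ### The common scale of the two tails -/

/-- The scale `tail F + tail G` relative to which all error terms are measured. -/
noncomputable def tailSum (F G : Measure ℝ) (x : ℝ) : ℝ := tail F x + tail G x

/-- The tail of `U` is eventually `a * tail F + b * tail G`, up to an error whose upper limit
relative to `tailSum F G` is at most `u`. -/
def TailWithin (F G U : Measure ℝ) (a b u : ℝ) : Prop :=
  ∀ ε, 0 < ε → ∀ᶠ x in atTop,
    |tail U x - (a * tail F x + b * tail G x)| ≤ (u + ε) * tailSum F G x

section

variable {α : ℝ} {F G : Measure ℝ}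

theorem tailSum_nonneg (x : ℝ) : 0 ≤ tailSum F G x := add_nonneg (tail_nonneg _ _) (tail_nonneg _ _)

theorem tail_left_le (x : ℝ) : tail F x ≤ tailSum F G x :=
  le_add_of_nonneg_right (tail_nonneg _ _)

theorem tail_right_le (x : ℝ) : tail G x ≤ tailSum F G x :=
  le_add_of_nonneg_left (tail_nonneg _ _)

theorem RegPair.tailSum_pos (hp : RegPair α F G) (x : ℝ) : 0 < tailSum F G x := hp.pos x

theorem RegPair.abs_tail_left_le (hp : RegPair α F G) {y : ℝ} (hy : 0 < y) {ε : ℝ} (hε : 0 < ε) :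
    ∀ᶠ x in atTop, |tail F (x / y) - y ^ α * tail F x| ≤ ε * tailSum F G x := by
  filter_upwards [(hp.regF y hy).def hε] with x hx
  simp only [Real.norm_eq_abs] at hx
  rwa [abs_of_pos (hp.pos x)] at hx

theorem RegPair.abs_tail_right_le (hp : RegPair α F G) {y : ℝ} (hy : 0 < y) {ε : ℝ} (hε : 0 < ε) :
    ∀ᶠ x in atTop, |tail G (x / y) - y ^ α * tail G x| ≤ ε * tailSum F G x := by
  filter_upwards [(hp.regG y hy).def hε] with x hx
  simp only [Real.norm_eq_abs] at hx
  rwa [abs_of_pos (hp.pos x)] at hx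

theorem RegPair.tailSum_div_le (hp : RegPair α F G) {y : ℝ} (hy : 0 < y) :
    ∀ᶠ x in atTop, tailSum F G (x / y) ≤ (y ^ α + 1) * tailSum F G x := by
  filter_upwards [hp.abs_tail_left_le hy (ε := 1 / 2) (by norm_num),
    hp.abs_tail_right_le hy (ε := 1 / 2) (by norm_num)] with x h1 h2
  have h1 := (abs_le.1 h1).2
  have h2 := (abs_le.1 h2).2
  unfold tailSum at *
  linarith

/-- The tails vary little on a small multiplicative scale. -/
theorem RegPair.exists_small_scale (hp : RegPair α F G) {ε : ℝ} (hε : 0 < ε) :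
    ∃ δ, 0 < δ ∧ δ < 1 ∧ ∀ᶠ x in atTop,
      tail F ((1 - δ) * x) ≤ tail F x + ε * tailSum F G x ∧
      tail G ((1 - δ) * x) ≤ tail G x + ε * tailSum F G x ∧
      tail F x - ε * tailSum F G x ≤ tail F ((1 + δ) * x) ∧
      tail G x - ε * tailSum F G x ≤ tail G ((1 + δ) * x) := by
  have hc : ∀ s : ℝ, Tendsto (fun δ : ℝ => ((1 + s * δ)⁻¹) ^ α) (𝓝[>] 0) (𝓝 1) := by
    intro s
    have h1 : ContinuousAt (fun δ : ℝ => ((1 + s * δ)⁻¹) ^ α) 0 := by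
      refine ContinuousAt.rpow_const (ContinuousAt.inv₀ (by fun_prop) (by simp)) (Or.inl (by simp))
    have h2 := h1.tendsto
    simp only [mul_zero, add_zero, inv_one, Real.one_rpow] at h2
    exact tendsto_nhdsWithin_of_tendsto_nhds h2
  obtain ⟨δ, ⟨h1, h2⟩, h3, h4⟩ := (((hc (-1)).eventually_le_const
    (show (1 : ℝ) < 1 + ε / 2 by linarith)).and ((hc 1).eventually_const_le
    (show 1 - ε / 2 < (1 : ℝ) by linarith))).and (Ioo_mem_nhdsGT (show (0 : ℝ) < 1 by norm_num))
    |>.exists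
  refine ⟨δ, h3, h4, ?_⟩
  have hy1 : 0 < (1 + -1 * δ)⁻¹ := inv_pos.2 (by linarith)
  have hy2 : 0 < (1 + 1 * δ)⁻¹ := inv_pos.2 (by linarith)
  filter_upwards [hp.abs_tail_left_le hy1 (half_pos hε), hp.abs_tail_right_le hy1 (half_pos hε),
    hp.abs_tail_left_le hy2 (half_pos hε), hp.abs_tail_right_le hy2 (half_pos hε)]
    with x e1 e2 e3 e4
  have hF := tail_nonneg F x
  have hG := tail_nonneg G x
  have hF' := tail_left_le (F := F) (G := G) x
  have hG' := tail_right_le (F := F) (G := G) x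
  have d1 : x / (1 + -1 * δ)⁻¹ = (1 - δ) * x := by rw [div_inv_eq_mul]; ring
  have d2 : x / (1 + 1 * δ)⁻¹ = (1 + δ) * x := by rw [div_inv_eq_mul]; ring
  rw [d1] at e1 e2
  rw [d2] at e3 e4
  refine ⟨?_, ?_, ?_, ?_⟩
  · nlinarith [(abs_le.1 e1).2]
  · nlinarith [(abs_le.1 e2).2]
  · nlinarith [(abs_le.1 e3).1]
  · nlinarith [(abs_le.1 e4).1]

theorem TailWithin.eventually_le {U : Measure ℝ} {a b u : ℝ} (h : TailWithin F G U a b u)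
    (ha : 0 ≤ a) (hb : 0 ≤ b) : ∀ᶠ x in atTop, tail U x ≤ (a + b + u + 1) * tailSum F G x := by
  filter_upwards [h 1 one_pos] with x hx
  have h1 := (abs_le.1 hx).2
  have hF := mul_le_mul_of_nonneg_left (tail_left_le (F := F) (G := G) x) ha
  have hG := mul_le_mul_of_nonneg_left (tail_right_le (F := F) (G := G) x) hb
  linarith

theorem tail_conv_eq_prod (F U : Measure ℝ) [IsProbabilityMeasure U] (t : ℝ) :
    tail (F.conv U) t = (F.prod U).real {p | t < p.1 + p.2} := by
  unfold tail Measure.conv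
  rw [map_measureReal_apply (by fun_prop) measurableSet_Ioi]
  rfl

variable [IsProbabilityMeasure F] [IsProbabilityMeasure G]

theorem tailSum_antitone : Antitone (tailSum F G) :=
  (tail_antitone F).add (tail_antitone G)

theorem tailSum_tendsto_zero : Tendsto (tailSum F G) atTop (𝓝 0) := by
  have := (tail_tendsto_zero F).add (tail_tendsto_zero G)
  rwa [add_zero] at this

theorem tail_add_measure (x : ℝ) : tail (F + G) x = tailSum F G x := by
  unfold tailSum tail
  rw [measureReal_add_apply]

/-- At any fixed fraction of the level, the squared scale is negligible. -/
theorem RegPair.tailSum_mul_sq_le (hp : RegPair α F G) {δ : ℝ} (hδ : 0 < δ) {ε : ℝ} (hε : 0 < ε) :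
    ∀ᶠ x in atTop, tailSum F G (δ * x) * tailSum F G (δ * x) ≤ ε * tailSum F G x := by
  have hd : 0 < (δ⁻¹ ^ α + 1) := by positivity
  have h0 : ∀ᶠ x in atTop, tailSum F G (δ * x) ≤ ε / (δ⁻¹ ^ α + 1) :=
    ((tailSum_tendsto_zero (F := F) (G := G)).comp
      (tendsto_id.const_mul_atTop hδ)).eventually_le_const (by positivity)
  filter_upwards [hp.tailSum_div_le (inv_pos.2 hδ), h0] with x h1 h2
  rw [div_inv_eq_mul, mul_comm x δ] at h1
  calc tailSum F G (δ * x) * tailSum F G (δ * x)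
      ≤ (ε / (δ⁻¹ ^ α + 1)) * ((δ⁻¹ ^ α + 1) * tailSum F G x) :=
        mul_le_mul h2 h1 (tailSum_nonneg _) (by positivity)
    _ = _ := by field_simp

/-! ### Tails of sums -/

theorem tail_conv_le (U : Measure ℝ) [IsProbabilityMeasure U] (δ t : ℝ) :
    tail (F.conv U) t ≤ tail F ((1 - δ) * t) + tail U ((1 - δ) * t)
      + tail F (δ * t) * tail U (δ * t) := by
  rw [tail_conv_eq_prod]
  have hsub : {p : ℝ × ℝ | t < p.1 + p.2} ⊆ (Set.Ioi ((1 - δ) * t) ×ˢ Set.univ ∪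
      Set.univ ×ˢ Set.Ioi ((1 - δ) * t)) ∪ Set.Ioi (δ * t) ×ˢ Set.Ioi (δ * t) := by
    rintro ⟨a, b⟩ h
    simp only [Set.mem_ofPred_eq, Set.mem_union, Set.mem_prod, Set.mem_Ioi, Set.mem_univ, and_true,
      true_and] at h ⊢
    by_contra! hc
    obtain ⟨⟨h1, h2⟩, h3⟩ := hc
    have := h3 (by linarith)
    linarith
  refine (measureReal_mono hsub).trans ((measureReal_union_le _ _).trans
    (add_le_add ((measureReal_union_le _ _).trans (add_le_add ?_ ?_)) ?_)) <;>
    simp [measureReal_prod_prod, tail]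

theorem le_tail_conv (U : Measure ℝ) [IsProbabilityMeasure U] (δ t : ℝ) :
    tail F ((1 + δ) * t) * (1 - U.real (Set.Iic (-(δ * t))))
      + tail U ((1 + δ) * t) * (1 - F.real (Set.Iic (-(δ * t))))
      - tail F ((1 + δ) * t) * tail U ((1 + δ) * t) ≤ tail (F.conv U) t := by
  rw [tail_conv_eq_prod]
  have hF : 1 - F.real (Set.Iic (-(δ * t))) = F.real (Set.Ioi (-(δ * t))) := by
    rw [← Set.compl_Iic, probReal_compl_eq_one_sub measurableSet_Iic]
  have hU : 1 - U.real (Set.Iic (-(δ * t))) = U.real (Set.Ioi (-(δ * t))) := by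
    rw [← Set.compl_Iic, probReal_compl_eq_one_sub measurableSet_Iic]
  set A : Set (ℝ × ℝ) := Set.Ioi ((1 + δ) * t) ×ˢ Set.Ioi (-(δ * t)) with hA
  set B : Set (ℝ × ℝ) := Set.Ioi (-(δ * t)) ×ˢ Set.Ioi ((1 + δ) * t) with hB
  have hAB : (F.prod U).real (A ∩ B) ≤ tail F ((1 + δ) * t) * tail U ((1 + δ) * t) := by
    unfold tail
    rw [← measureReal_prod_prod]
    exact measureReal_mono fun p hp => ⟨hp.1.1, hp.2.2⟩
  have hsub : A ∪ B ⊆ {p : ℝ × ℝ | t < p.1 + p.2} := by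
    rintro ⟨a, b⟩ (⟨h1, h2⟩ | ⟨h1, h2⟩) <;> simp only [Set.mem_Ioi, Set.mem_ofPred_eq] at * <;>
      linarith
  have hu := measureReal_union_add_inter (μ := F.prod U) (s := A)
    (measurableSet_Ioi.prod measurableSet_Ioi : MeasurableSet B)
  have hm := measureReal_mono (μ := F.prod U) hsub
  rw [hF, hU]
  rw [show (F.prod U).real A = _ from measureReal_prod_prod _ _,
    show (F.prod U).real B = _ from measureReal_prod_prod _ _] at hu
  unfold tail at hAB ⊢
  linarith

theorem tendsto_Iic_neg_mul (U : Measure ℝ) [IsProbabilityMeasure U] {δ : ℝ} (hδ : 0 < δ) :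
    Tendsto (fun t => U.real (Set.Iic (-(δ * t)))) atTop (𝓝 0) := by
  have h := tendsto_measure_iInter_atTop (μ := U) (s := fun t : ℝ => Set.Iic (-t))
    (fun _ => measurableSet_Iic.nullMeasurableSet)
    (fun _ _ h => Set.Iic_subset_Iic.2 (neg_le_neg h)) ⟨0, measure_ne_top _ _⟩
  have h0 : ⋂ t : ℝ, Set.Iic (-t) = ∅ := by
    ext y
    simp only [Set.mem_iInter, Set.mem_Iic, Set.mem_empty_iff_false, iff_false, not_forall]
    exact ⟨1 - y, by linarith⟩
  rw [h0, measure_empty] at h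
  have h2 := ((ENNReal.tendsto_toReal ENNReal.zero_ne_top).comp h).comp
    (tendsto_id.const_mul_atTop hδ)
  exact h2

/-- A large sum of independent terms is due to one of the two. -/
theorem RegPair.tailWithin_conv (hp : RegPair α F G) {U : Measure ℝ} [IsProbabilityMeasure U]
    {a b u : ℝ} (ha : 0 ≤ a) (hb : 0 ≤ b) (hu : 0 ≤ u) (h : TailWithin F G U a b u) :
    TailWithin F G (F.conv U) (1 + a) b u := by
  intro ε hε
  set C := a + b + u + 1 with hC
  have hC0 : 0 < C := by positivity
  obtain ⟨e, he, he1, heε⟩ : ∃ e, 0 < e ∧ e ≤ 1 ∧ (a + b + 2 * u + 6) * e ≤ ε := by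
    refine ⟨min 1 (ε / (a + b + 2 * u + 6)), by positivity, min_le_left _ _, ?_⟩
    rw [← le_div_iff₀' (by positivity)]
    exact min_le_right _ _
  obtain ⟨δ, hδ, hδ1, hs⟩ := hp.exists_small_scale he
  have l1 : Tendsto (fun x : ℝ => (1 - δ) * x) atTop atTop :=
    tendsto_id.const_mul_atTop (by linarith)
  have l2 : Tendsto (fun x : ℝ => (1 + δ) * x) atTop atTop :=
    tendsto_id.const_mul_atTop (by linarith)
  have l3 : Tendsto (fun x : ℝ => δ * x) atTop atTop := tendsto_id.const_mul_atTop hδ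
  have hUb := h.eventually_le ha hb
  have hz : ∀ᶠ x in atTop, tailSum F G x ≤ e / C :=
    (tailSum_tendsto_zero (F := F) (G := G)).eventually_le_const (by positivity)
  filter_upwards [hs, l1.eventually (h e he), l2.eventually (h e he), l3.eventually hUb,
    l2.eventually hUb, hp.tailSum_mul_sq_le hδ (ε := e / C) (by positivity), hz,
    (tendsto_Iic_neg_mul U hδ).eventually_le_const he,
    (tendsto_Iic_neg_mul F hδ).eventually_le_const (show 0 < e / C by positivity),
    eventually_ge_atTop 0]
    with x ⟨s1, s2, s3, s4⟩ w1 w2 b3 b2 q z iU iF hx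
  have hq0 := tailSum_nonneg (F := F) (G := G) x
  rw [le_div_iff₀ hC0] at z iF
  have hqC : C * (tailSum F G (δ * x) * tailSum F G (δ * x)) ≤ e * tailSum F G x := by
    calc _ ≤ C * (e / C * tailSum F G x) := by gcongr
      _ = _ := by field_simp
  rw [abs_le]
  constructor
  · have hl := le_tail_conv (F := F) U δ x
    have hmono : tailSum F G ((1 + δ) * x) ≤ tailSum F G x := tailSum_antitone (by nlinarith)
    have hq2 := tailSum_nonneg (F := F) (G := G) ((1 + δ) * x)
    have hF2 := tail_left_le (F := F) (G := G) ((1 + δ) * x)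
    have hF20 := tail_nonneg F ((1 + δ) * x)
    have hU20 := tail_nonneg U ((1 + δ) * x)
    have w2 := (abs_le.1 w2).1
    have p1 : tail F ((1 + δ) * x) * U.real (Set.Iic (-(δ * x))) ≤ e * tailSum F G x := by
      rw [mul_comm e]
      exact mul_le_mul (hF2.trans hmono) iU measureReal_nonneg hq0
    have p2 : tail U ((1 + δ) * x) * F.real (Set.Iic (-(δ * x))) ≤ e * tailSum F G x := by
      calc _ ≤ (C * tailSum F G x) * F.real (Set.Iic (-(δ * x))) := by
            refine mul_le_mul_of_nonneg_right (b2.trans ?_) measureReal_nonneg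
            gcongr
        _ = (F.real (Set.Iic (-(δ * x))) * C) * tailSum F G x := by ring
        _ ≤ _ := by gcongr
    have p3 : tail F ((1 + δ) * x) * tail U ((1 + δ) * x) ≤ e * tailSum F G x := by
      calc _ ≤ tailSum F G x * (C * tailSum F G x) := by
            refine mul_le_mul (hF2.trans hmono) (b2.trans ?_) hU20 hq0
            gcongr
        _ = (tailSum F G x * C) * tailSum F G x := by ring
        _ ≤ _ := by gcongr
    have p4 : (u + e) * tailSum F G ((1 + δ) * x) ≤ (u + e) * tailSum F G x := by gcongr
    have p5 := mul_le_mul_of_nonneg_left s3 ha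
    have p6 := mul_le_mul_of_nonneg_left s4 hb
    have p7 : (a + b + 5) * e * tailSum F G x ≤ ε * tailSum F G x := by
      refine mul_le_mul_of_nonneg_right (le_trans ?_ heε) hq0
      exact mul_le_mul_of_nonneg_right (by linarith) he.le
    linarith
  · have hl := tail_conv_le (F := F) U δ x
    have w1 := (abs_le.1 w1).2
    have p1 : tail F (δ * x) * tail U (δ * x) ≤ e * tailSum F G x := by
      refine le_trans ?_ hqC
      calc _ ≤ tailSum F G (δ * x) * (C * tailSum F G (δ * x)) :=
            mul_le_mul (tail_left_le _) b3 (tail_nonneg _ _) (tailSum_nonneg _)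
        _ = _ := by ring
    have p2 : tailSum F G ((1 - δ) * x) ≤ (1 + 2 * e) * tailSum F G x := by
      unfold tailSum at *
      linarith
    have p4 := mul_le_mul_of_nonneg_left p2 (show 0 ≤ u + e by positivity)
    have p5 := mul_le_mul_of_nonneg_left s1 ha
    have p6 := mul_le_mul_of_nonneg_left s2 hb
    have p7 : (a + b + 2 * u + 6) * e * tailSum F G x ≤ ε * tailSum F G x :=
      mul_le_mul_of_nonneg_right heε hq0
    have p8 : e * e * tailSum F G x ≤ e * tailSum F G x :=
      mul_le_mul_of_nonneg_right (by nlinarith) hq0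
    have p9 : 0 ≤ e * tailSum F G x := by positivity
    linarith

/-- A bound for tails of sums that is uniform in the law `U` of the second summand. -/
theorem RegPair.tail_conv_le_uniform (hp : RegPair α F G) {η : ℝ} (hη : 0 < η) :
    ∃ t₀, 0 < t₀ ∧ ∀ (U : Measure ℝ) [IsProbabilityMeasure U] (κ : ℝ), 0 ≤ κ →
      (∀ x, 0 ≤ x → tail U x ≤ κ * tailSum F G x) →
      ∀ t, t₀ ≤ t → tail (F.conv U) t ≤ ((1 + η) * κ + (1 + η)) * tailSum F G t := by
  obtain ⟨δ, hδ, hδ1, hs⟩ := hp.exists_small_scale (show 0 < η / 3 by positivity)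
  obtain ⟨t₀, ht⟩ := eventually_atTop.1
    (hs.and (hp.tailSum_mul_sq_le hδ (ε := η / 3) (by positivity)))
  refine ⟨max t₀ 1, by positivity, fun U _ κ hκ hU t htt => ?_⟩
  obtain ⟨⟨s1, s2, -, -⟩, q⟩ := ht t ((le_max_left _ _).trans htt)
  have ht0 : 0 ≤ t := by linarith [(le_max_right t₀ 1).trans htt]
  have h0 := tailSum_nonneg (F := F) (G := G) t
  have u1 := hU ((1 - δ) * t) (mul_nonneg (by linarith) ht0)
  have u2 := hU (δ * t) (by positivity)
  have p1 : tail F (δ * t) * tail U (δ * t) ≤ κ * (η / 3 * tailSum F G t) := by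
    calc _ ≤ tailSum F G (δ * t) * (κ * tailSum F G (δ * t)) :=
          mul_le_mul (tail_left_le _) u2 (tail_nonneg _ _) (tailSum_nonneg _)
      _ = κ * (tailSum F G (δ * t) * tailSum F G (δ * t)) := by ring
      _ ≤ _ := by gcongr
  have p2 : tailSum F G ((1 - δ) * t) ≤ (1 + 2 * (η / 3)) * tailSum F G t := by
    unfold tailSum at *
    linarith
  have p3 := mul_le_mul_of_nonneg_left p2 hκ
  have p4 := tail_conv_le (F := F) U δ t
  have p5 := tail_left_le (F := F) (G := G) t
  have p6 : 0 ≤ η * tailSum F G t := by positivity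
  nlinarith

end

/-! ### Tails of products -/

theorem posPow_eq_of_pos {α z : ℝ} (hz : 0 < z) : posPow α z = z ^ α := if_pos hz

theorem posPow_eq_zero {α z : ℝ} (hz : z ≤ 0) : posPow α z = 0 := if_neg hz.not_gt

theorem posPow_monotone {α : ℝ} (hα : 0 ≤ α) : Monotone (posPow α) := by
  intro x y hxy
  rcases le_or_gt x 0 with hx | hx
  · rw [posPow_eq_zero hx]
    exact posPow_nonneg _ _
  · rw [posPow_eq_of_pos hx, posPow_eq_of_pos (hx.trans_le hxy)]
    exact Real.rpow_le_rpow hx.le hxy hα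

theorem isOpen_lt_posPow (α : ℝ) {s : ℝ} (hs : 0 ≤ s) : IsOpen {z | s < posPow α z} := by
  have h : {z | s < posPow α z} = Set.Ioi 0 ∩ (fun z : ℝ => z ^ α) ⁻¹' Set.Ioi s := by
    ext z
    rcases le_or_gt z 0 with hz | hz
    · simp [posPow_eq_zero hz, hz.not_gt, hs.not_gt]
    · simp [posPow_eq_of_pos hz, hz]
  rw [h]
  refine ContinuousOn.isOpen_inter_preimage (fun z hz => ?_) isOpen_Ioi isOpen_Ioi
  exact (Real.continuousAt_rpow_const _ _ (Or.inl (ne_of_gt hz))).continuousWithinAt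

theorem tail_mconv_eq_prod (G R : Measure ℝ) [IsProbabilityMeasure R] (x : ℝ) :
    tail (G.mconv R) x = (G.prod R).real {p | x < p.1 * p.2} := by
  unfold tail Measure.mconv
  rw [map_measureReal_apply (by fun_prop) measurableSet_Ioi]
  rfl

section Product

variable {α : ℝ} {F G : Measure ℝ}

theorem setIntegral_rpow_eq {ν : Measure ℝ} (K : ℝ) :
    ∫ y in Set.Ioc 0 K, y ^ α ∂ν = ∫ y in Set.Iic K, posPow α y ∂ν := by
  rw [← integral_indicator measurableSet_Ioc, ← integral_indicator measurableSet_Iic]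
  refine integral_congr_ae (ae_of_all _ fun y => ?_)
  by_cases hy : 0 < y <;> by_cases hK : y ≤ K <;> simp [Set.indicator, hy, hK, posPow]

theorem tendsto_setIntegral_rpow {ν : Measure ℝ} (h : Integrable (posPow α) ν) :
    Tendsto (fun K : ℝ => ∫ y in Set.Ioc 0 K, y ^ α ∂ν) atTop (𝓝 (∫ y, posPow α y ∂ν)) := by
  simp_rw [setIntegral_rpow_eq]
  exact (aecover_Iic (μ := ν) tendsto_id).integral_tendsto_of_countably_generated h

theorem setIntegral_rpow_le {ν : Measure ℝ} (h : Integrable (posPow α) ν) (K : ℝ) :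
    ∫ y in Set.Ioc 0 K, y ^ α ∂ν ≤ ∫ y, posPow α y ∂ν := by
  rw [setIntegral_rpow_eq]
  exact setIntegral_le_integral h (ae_of_all _ (posPow_nonneg α))

theorem integrable_tail_div (W ν : Measure ℝ) [IsProbabilityMeasure W] [IsFiniteMeasure ν] (x : ℝ) :
    Integrable (fun y => tail W (x / y)) ν :=
  Integrable.of_bound ((tail_measurable W).comp
    (measurable_const.div measurable_id)).aestronglyMeasurable 1 (ae_of_all _ fun y => by
      rw [Real.norm_of_nonneg (tail_nonneg _ _)]; exact tail_le_one _ _)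

/-- The contribution of a bounded factor to the tail of a product, by dominated convergence. -/
theorem RegPair.abs_setIntegral_tail_div_sub_le [IsProbabilityMeasure F] [IsProbabilityMeasure G]
    (hp : RegPair α F G) {W ν : Measure ℝ} [IsProbabilityMeasure W] [IsFiniteMeasure ν]
    (hW : ∀ x, tail W x ≤ tailSum F G x)
    (hreg : ∀ y, 0 < y → (fun x => tail W (x / y) - y ^ α * tail W x) =o[atTop] tailSum F G)
    {K : ℝ} (hK : 0 < K) {ε : ℝ} (hε : 0 < ε) :
    ∀ᶠ x in atTop, |∫ y in Set.Ioc 0 K, tail W (x / y) ∂ν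
      - (∫ y in Set.Ioc 0 K, y ^ α ∂ν) * tail W x| ≤ ε * tailSum F G x := by
  have hpow : IntegrableOn (fun y : ℝ => y ^ α) (Set.Ioc 0 K) ν := by
    refine Measure.integrableOn_of_bounded (M := K ^ α) (measure_ne_top _ _)
      (by fun_prop : Measurable fun y : ℝ => y ^ α).aestronglyMeasurable ?_
    filter_upwards [ae_restrict_mem measurableSet_Ioc] with y hy
    rw [Real.norm_of_nonneg (Real.rpow_nonneg hy.1.le _)]
    exact Real.rpow_le_rpow hy.1.le hy.2 hp.nonneg
  have hlim : Tendsto (fun x => ∫ y in Set.Ioc 0 K,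
      (tail W (x / y) - y ^ α * tail W x) / tailSum F G x ∂ν) atTop
      (𝓝 (∫ y in Set.Ioc 0 K, (0 : ℝ) ∂ν)) := by
    refine tendsto_integral_filter_of_dominated_convergence (fun _ => 2 * K ^ α + 1)
      (Eventually.of_forall fun x => ?_) ?_ (integrable_const _) ?_
    · exact ((((tail_measurable W).comp (measurable_const.div measurable_id)).sub
        ((by fun_prop : Measurable fun y : ℝ => y ^ α).mul_const _)).div_const
          _).aestronglyMeasurable
    · filter_upwards [hp.tailSum_div_le hK, eventually_ge_atTop 0] with x hx hx0
      filter_upwards [ae_restrict_mem measurableSet_Ioc] with y hy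
      have hpos := hp.tailSum_pos x
      rw [norm_div, Real.norm_of_nonneg hpos.le, div_le_iff₀ hpos, Real.norm_eq_abs]
      have h1 : tail W (x / y) ≤ (K ^ α + 1) * tailSum F G x :=
        ((tail_antitone W (div_le_div_of_nonneg_left hx0 hy.1 hy.2)).trans (hW _)).trans hx
      have h2 : y ^ α * tail W x ≤ K ^ α * tailSum F G x :=
        mul_le_mul (Real.rpow_le_rpow hy.1.le hy.2 hp.nonneg) (hW x) (tail_nonneg _ _)
          (Real.rpow_nonneg hK.le _)
      have h3 := tail_nonneg W (x / y)
      have h4 := mul_nonneg (Real.rpow_nonneg hy.1.le α) (tail_nonneg W x)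
      have h5 := mul_nonneg (Real.rpow_nonneg hK.le α) hpos.le
      rw [abs_le]
      constructor <;> linarith
    · filter_upwards [ae_restrict_mem measurableSet_Ioc] with y hy
      exact (hreg y hy.1).tendsto_div_nhds_zero
  rw [integral_zero] at hlim
  filter_upwards [hlim.abs.eventually_le_const (by simpa using hε)] with x hx
  have hpos := hp.tailSum_pos x
  rw [integral_div, abs_div, abs_of_pos hpos, div_le_iff₀ hpos,
    integral_sub (integrable_tail_div W _ x) (hpow.mul_const _), integral_mul_const] at hx
  exact hx

theorem prod_real_setOf_le_lt_mul {G R : Measure ℝ} [IsProbabilityMeasure G]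
    [IsProbabilityMeasure R] (K x : ℝ) :
    (G.prod R).real {p | (0 < p.1 ∧ p.1 ≤ K) ∧ x < p.1 * p.2}
      = ∫ y in Set.Ioc 0 K, tail R (x / y) ∂G := by
  have hA : MeasurableSet {p : ℝ × ℝ | (0 < p.1 ∧ p.1 ≤ K) ∧ x < p.1 * p.2} :=
    ((measurableSet_lt measurable_const measurable_fst).inter
      (measurableSet_le measurable_fst measurable_const)).inter
        (measurableSet_lt measurable_const (measurable_fst.mul measurable_snd))
  rw [← ENNReal.toReal_ofReal (integral_nonneg fun y => tail_nonneg _ _), measureReal_def,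
    ofReal_integral_eq_lintegral_ofReal (integrable_tail_div R _ x)
      (ae_of_all _ fun y => tail_nonneg _ _),
    Measure.prod_apply hA, ← lintegral_indicator measurableSet_Ioc]
  congr 1
  refine lintegral_congr fun y => ?_
  by_cases hy : y ∈ Set.Ioc 0 K
  · rw [Set.indicator_of_mem hy, ofReal_tail]
    congr 1
    ext z
    simp [hy.1, hy.2, div_lt_iff₀' hy.1]
  · rw [Set.indicator_of_notMem hy]
    have : Prod.mk y ⁻¹' {p : ℝ × ℝ | (0 < p.1 ∧ p.1 ≤ K) ∧ x < p.1 * p.2} = ∅ := by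
      ext z
      simp only [Set.mem_preimage, Set.mem_ofPred_eq, Set.mem_empty_iff_false, iff_false, not_and]
      exact fun h => absurd h hy
    rw [this, measure_empty]

/-- A product that exceeds `x > K ^ 2` has one factor at most `K`, or two factors exceeding `K`. -/
theorem tail_mconv_eq {G R : Measure ℝ} [IsProbabilityMeasure G] [IsProbabilityMeasure R]
    (hG : G (Set.Iic 0) = 0) {K x : ℝ} (hK : 0 < K) (hx : K ^ 2 < x) :
    tail (G.mconv R) x = ∫ y in Set.Ioc 0 K, tail R (x / y) ∂G
      + ∫ z in Set.Ioc 0 K, tail G (x / z) ∂(R)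
      + (G.prod R).real {p | K < p.1 ∧ K < p.2 ∧ x < p.1 * p.2} := by
  have hx0 : 0 < x := lt_of_le_of_lt (sq_nonneg K) hx
  have hms : MeasurableSet {p : ℝ × ℝ | x < p.1 * p.2} :=
    measurableSet_lt measurable_const (measurable_fst.mul measurable_snd)
  have hB : MeasurableSet {p : ℝ × ℝ | (0 < p.2 ∧ p.2 ≤ K) ∧ x < p.1 * p.2} :=
    ((measurableSet_lt measurable_const measurable_snd).inter
      (measurableSet_le measurable_snd measurable_const)).inter hms
  have hpos : ∀ᵐ p ∂(G.prod R), 0 < p.1 := by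
    have h1 : ∀ᵐ y ∂G, 0 < y := by
      rw [ae_iff]
      convert hG using 2
      ext y
      simp
    exact Measure.quasiMeasurePreserving_fst.ae h1
  have hBv : (G.prod R).real {p | (0 < p.2 ∧ p.2 ≤ K) ∧ x < p.1 * p.2}
      = ∫ z in Set.Ioc 0 K, tail G (x / z) ∂(R) := by
    rw [← prod_real_setOf_le_lt_mul, ← Measure.prod_swap,
      map_measureReal_apply measurable_swap hB]
    congr 1
    ext p
    simp [mul_comm]
  rw [tail_mconv_eq_prod, ← prod_real_setOf_le_lt_mul, ← hBv,
    ← measureReal_union _ hB, ← measureReal_union _ (measurableSet_both_large K x)]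
  · refine measureReal_congr ?_
    filter_upwards [hpos] with p hp
    apply propext
    change x < p.1 * p.2 ↔ (((0 < p.1 ∧ p.1 ≤ K) ∧ x < p.1 * p.2) ∨
      ((0 < p.2 ∧ p.2 ≤ K) ∧ x < p.1 * p.2)) ∨ (K < p.1 ∧ K < p.2 ∧ x < p.1 * p.2)
    constructor
    · intro h
      have h2 : 0 < p.2 := (mul_pos_iff_of_pos_left hp).1 (hx0.trans h)
      rcases le_or_gt p.1 K with h3 | h3 <;> rcases le_or_gt p.2 K with h4 | h4 <;> grind
    · grind
  · rw [Set.disjoint_left]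
    rintro p (⟨h, -⟩ | ⟨h, -⟩) ⟨h3, h4, -⟩ <;> linarith [h.2]
  · rw [Set.disjoint_left]
    rintro p ⟨h, h'⟩ ⟨h3, -⟩
    nlinarith [mul_le_mul h.2 h3.2 h3.1.le hK.le]

/-- Comparison of the events that both factors are large. -/
theorem both_large_le [IsProbabilityMeasure F] [IsProbabilityMeasure G] {R : Measure ℝ}
    [IsProbabilityMeasure R] {K C : ℝ} (hK : 0 < K) (hC : 0 ≤ C)
    (hR : ∀ t, K ≤ t → tail R t ≤ C * tailSum F G t) (x : ℝ) :
    (G.prod R).real {p | K < p.1 ∧ K < p.2 ∧ x < p.1 * p.2}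
      ≤ C * ((F + G).prod (F + G)).real {p | K < p.1 ∧ K < p.2 ∧ x < p.1 * p.2} := by
  have hA := measurableSet_both_large K x
  have hGle : G ≤ F + G := Measure.le_add_left le_rfl
  have hmain : (G.prod R) {p | K < p.1 ∧ K < p.2 ∧ x < p.1 * p.2}
      ≤ ENNReal.ofReal C * ((F + G).prod (F + G)) {p | K < p.1 ∧ K < p.2 ∧ x < p.1 * p.2} := by
    rw [Measure.prod_apply hA, Measure.prod_apply hA,
      ← lintegral_const_mul _ (measurable_measure_prodMk_left hA)]
    refine (lintegral_mono fun y => ?_).trans (lintegral_mono' hGle le_rfl)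
    by_cases hy : K < y
    · have hs : Prod.mk y ⁻¹' {p : ℝ × ℝ | K < p.1 ∧ K < p.2 ∧ x < p.1 * p.2}
          = Set.Ioi (max K (x / y)) := by
        ext z
        simp [hy, div_lt_iff₀' (hK.trans hy)]
      rw [hs, ← ofReal_tail, ← ofReal_tail, ← ENNReal.ofReal_mul hC, tail_add_measure]
      exact ENNReal.ofReal_le_ofReal (hR _ (le_max_left _ _))
    · have hs : Prod.mk y ⁻¹' {p : ℝ × ℝ | K < p.1 ∧ K < p.2 ∧ x < p.1 * p.2} = ∅ := by
        ext z
        simp [hy]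
      simp [hs]
  have h2 := ENNReal.toReal_mono (ENNReal.mul_ne_top ENNReal.ofReal_ne_top (measure_ne_top _ _))
    hmain
  rwa [ENNReal.toReal_mul, ENNReal.toReal_ofReal hC] at h2

/-- A large product is due to one of its factors; the other one contributes through its moment. -/
theorem RegPair.tailWithin_mconv [IsProbabilityMeasure F] [IsProbabilityMeasure G]
    (hp : RegPair α F G) (hG : G (Set.Iic 0) = 0) {R : Measure ℝ} [IsProbabilityMeasure R]
    (hRi : Integrable (posPow α) R) {a b u : ℝ} (ha : 0 ≤ a) (hb : 0 ≤ b) (hu : 0 ≤ u)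
    (h : TailWithin F G R a b u) :
    TailWithin F G (G.mconv R) ((∫ y, posPow α y ∂G) * a)
      ((∫ y, posPow α y ∂G) * b + ∫ z, posPow α z ∂(R)) ((∫ y, posPow α y ∂G) * u) := by
  intro ε hε
  set μ := ∫ y, posPow α y ∂G with hμ
  set ρ := ∫ z, posPow α z ∂(R) with hρ
  have hμ0 : 0 ≤ μ := integral_nonneg fun y => posPow_nonneg _ _
  set C := a + b + u + 1 with hC
  have hC0 : 0 < C := by positivity
  obtain ⟨e, he, he1, heε⟩ : ∃ e, 0 < e ∧ e ≤ 1 ∧ (2 * a + 2 * b + 2 * u + 5 + μ + C) * e ≤ ε := by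
    refine ⟨min 1 (ε / (2 * a + 2 * b + 2 * u + 5 + μ + C)), by positivity, min_le_left _ _, ?_⟩
    rw [← le_div_iff₀' (by positivity)]
    exact min_le_right _ _
  obtain ⟨t₀, ht₀⟩ := eventually_atTop.1 ((h.eventually_le ha hb).and (h e he))
  obtain ⟨K, ⟨⟨hN, hKt⟩, hK1⟩, hKμ, hKρ⟩ := ((((hp.negl e he).and (eventually_ge_atTop t₀)).and
    (eventually_ge_atTop 1)).and (((tendsto_setIntegral_rpow hp.intG).eventually_const_le
      (show μ - e < μ by linarith)).and ((tendsto_setIntegral_rpow hRi).eventually_const_le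
      (show ρ - e < ρ by linarith)))).exists
  have hK : 0 < K := by linarith
  set mK := ∫ y in Set.Ioc 0 K, y ^ α ∂G with hmK
  set rK := ∫ y in Set.Ioc 0 K, y ^ α ∂(R) with hrK
  have hmKle : mK ≤ μ := setIntegral_rpow_le hp.intG K
  have hrKle : rK ≤ ρ := setIntegral_rpow_le hRi K
  filter_upwards [hN,
    hp.abs_setIntegral_tail_div_sub_le (ν := G) tail_left_le hp.regF hK he,
    hp.abs_setIntegral_tail_div_sub_le (ν := G) tail_right_le hp.regG hK he,
    hp.abs_setIntegral_tail_div_sub_le (ν := R) tail_right_le hp.regG hK he,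
    eventually_gt_atTop (K ^ 2), eventually_ge_atTop (K * t₀)] with x n i1 i2 i3 hxK hxt
  have hx0 : 0 < x := lt_of_le_of_lt (sq_nonneg K) hxK
  rw [← hmK] at i1 i2
  rw [← hrK] at i3
  have hbl := both_large_le (F := F) (G := G) (R := R) (C := C) hK hC0.le
    (fun t ht => (ht₀ t (hKt.trans ht)).1) x
  have hbl0 : 0 ≤ (G.prod R).real {p | K < p.1 ∧ K < p.2 ∧ x < p.1 * p.2} := measureReal_nonneg
  have hF := tail_nonneg F x
  have hGx := tail_nonneg G x
  have hq := hp.tailSum_pos x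
  have hF' := tail_left_le (F := F) (G := G) x
  have hG' := tail_right_le (F := F) (G := G) x
  have hq' : tailSum F G x = tail F x + tail G x := rfl
  have jF := (integrable_tail_div F (G.restrict (Set.Ioc 0 K)) x)
  have jG := (integrable_tail_div G (G.restrict (Set.Ioc 0 K)) x)
  have jR := (integrable_tail_div R (G.restrict (Set.Ioc 0 K)) x)
  set IF := ∫ y in Set.Ioc 0 K, tail F (x / y) ∂G with hIF
  set IG := ∫ y in Set.Ioc 0 K, tail G (x / y) ∂G with hIG
  -- the comparison of `R` with `a * F + b * G` under the integral over `y ≤ K`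
  have hmain : |∫ y in Set.Ioc 0 K, tail R (x / y) ∂G - (a * IF + b * IG)|
      ≤ (u + e) * (IF + IG) := by
    have e1 : ∫ y in Set.Ioc 0 K, tail R (x / y) ∂G - (a * IF + b * IG)
        = ∫ y in Set.Ioc 0 K, (tail R (x / y) - (a * tail F (x / y) + b * tail G (x / y))) ∂G := by
      have hs : Integrable (fun y => a * tail F (x / y) + b * tail G (x / y))
          (G.restrict (Set.Ioc 0 K)) := (jF.const_mul a).add (jG.const_mul b)
      rw [integral_sub jR hs, integral_add (jF.const_mul a) (jG.const_mul b), integral_const_mul, integral_const_mul]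
    have e2 : (u + e) * (IF + IG)
        = ∫ y in Set.Ioc 0 K, (u + e) * (tail F (x / y) + tail G (x / y)) ∂G := by
      rw [integral_const_mul, integral_add jF jG]
    rw [e1, e2, ← Real.norm_eq_abs]
    refine norm_integral_le_of_norm_le ((jF.add jG).const_mul _) ?_
    filter_upwards [ae_restrict_mem measurableSet_Ioc] with y hy
    rw [Real.norm_eq_abs]
    refine (ht₀ (x / y) ?_).2
    rw [le_div_iff₀ hy.1]
    rcases le_or_gt t₀ 0 with h0 | h0
    · exact (mul_nonpos_of_nonpos_of_nonneg h0 hy.1.le).trans hx0.le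
    · rw [mul_comm]
      exact (mul_le_mul_of_nonneg_right hy.2 h0.le).trans hxt
  rw [tail_mconv_eq hG hK hxK]
  obtain ⟨m1, m2⟩ := abs_le.1 hmain
  obtain ⟨i11, i12⟩ := abs_le.1 i1
  obtain ⟨i21, i22⟩ := abs_le.1 i2
  obtain ⟨i31, i32⟩ := abs_le.1 i3
  -- replacing truncated by full moments
  have k1 : mK * tail F x ≤ μ * tail F x := by gcongr
  have k2 : μ * tail F x - e * tail F x ≤ mK * tail F x := by
    rw [← sub_mul]; gcongr
  have k3 : mK * tail G x ≤ μ * tail G x := by gcongr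
  have k4 : μ * tail G x - e * tail G x ≤ mK * tail G x := by
    rw [← sub_mul]; gcongr
  have k5 : rK * tail G x ≤ ρ * tail G x := by gcongr
  have k6 : ρ * tail G x - e * tail G x ≤ rK * tail G x := by
    rw [← sub_mul]; gcongr
  have kF : |IF - μ * tail F x| ≤ 2 * e * tailSum F G x := by
    have := mul_le_mul_of_nonneg_left hF' he.le
    have := mul_nonneg he.le hq.le
    rw [abs_le]
    constructor <;> linarith
  have kG : |IG - μ * tail G x| ≤ 2 * e * tailSum F G x := by
    have := mul_le_mul_of_nonneg_left hG' he.le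
    have := mul_nonneg he.le hq.le
    rw [abs_le]
    constructor <;> linarith
  obtain ⟨f1, f2⟩ := abs_le.1 kF
  obtain ⟨g1, g2⟩ := abs_le.1 kG
  have s1 : (u + e) * (IF + IG) ≤ (u + e) * ((μ + 2 * e) * tailSum F G x) := by
    refine mul_le_mul_of_nonneg_left ?_ (by positivity)
    have hμq : μ * tailSum F G x = μ * tail F x + μ * tail G x := by rw [hq', mul_add]
    linarith
  have hN2 : (G.prod R).real {p | K < p.1 ∧ K < p.2 ∧ x < p.1 * p.2} ≤ C * (e * tailSum F G x) :=
    hbl.trans (mul_le_mul_of_nonneg_left n hC0.le)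
  have s1' : (u + e) * ((μ + 2 * e) * tailSum F G x)
      ≤ (μ * u + (2 * u + μ + 2) * e) * tailSum F G x := by
    rw [← mul_assoc]
    refine mul_le_mul_of_nonneg_right ?_ hq.le
    have he2 : e * e ≤ e * 1 := mul_le_mul_of_nonneg_left he1 he.le
    linarith
  have s2 := mul_le_mul_of_nonneg_left f1 ha
  have s3 := mul_le_mul_of_nonneg_left f2 ha
  have s4 := mul_le_mul_of_nonneg_left g1 hb
  have s5 := mul_le_mul_of_nonneg_left g2 hb
  have s6 := mul_le_mul_of_nonneg_left hG' he.le
  have s7 : (2 * a + 2 * b + 2 * u + 5 + μ + C) * e * tailSum F G x ≤ ε * tailSum F G x := by gcongr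
  have s8 : 0 ≤ e * tailSum F G x := by positivity
  have s9 : 0 ≤ C * (e * tailSum F G x) := by positivity
  clear_value C IF IG mK rK
  rw [abs_le]
  constructor <;> linarith

/-- A bound for tails of products that is uniform in the law `R` of the second factor. -/
theorem RegPair.tail_mconv_le_uniform [IsProbabilityMeasure F] [IsProbabilityMeasure G]
    (hp : RegPair α F G) (hG : G (Set.Iic 0) = 0) {η : ℝ} (hη : 0 < η) (t₀ : ℝ) :
    ∃ C x₀, 0 ≤ C ∧ ∀ (R : Measure ℝ) [IsProbabilityMeasure R] (κ : ℝ), 0 ≤ κ →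
      (∀ t, t₀ ≤ t → tail R t ≤ κ * tailSum F G t) →
      ∀ x, x₀ ≤ x →
        tail (G.mconv R) x ≤ (((∫ y, posPow α y ∂G) + η) * κ + C) * tailSum F G x := by
  set μ := ∫ y, posPow α y ∂G with hμ
  obtain ⟨K, ⟨hN, hKt⟩, hK1⟩ := (((hp.negl (η / 2) (by positivity)).and
    (eventually_ge_atTop t₀)).and (eventually_ge_atTop 1)).exists
  have hK : 0 < K := by linarith
  obtain ⟨x₀, hx₀⟩ := eventually_atTop.1 (hN.and
    ((hp.abs_setIntegral_tail_div_sub_le (ν := G) (ε := η / 4) tail_left_le hp.regF hK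
      (by positivity)).and
    ((hp.abs_setIntegral_tail_div_sub_le (ν := G) (ε := η / 4) tail_right_le hp.regG hK
      (by positivity)).and
    ((eventually_gt_atTop (K ^ 2)).and ((eventually_ge_atTop (K * t₀)).and
      (hp.tailSum_div_le hK))))))
  refine ⟨K ^ α + 1, x₀, by positivity, fun R _ κ hκ hR x hx => ?_⟩
  obtain ⟨n, i1, i2, hxK, hxt, hd⟩ := hx₀ x hx
  have hx0 : 0 < x := lt_of_le_of_lt (sq_nonneg K) hxK
  have hq := hp.tailSum_pos x
  have hmKle : ∫ y in Set.Ioc 0 K, y ^ α ∂G ≤ μ := setIntegral_rpow_le hp.intG K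
  have hbl := both_large_le (F := F) (G := G) (R := R) hK hκ
    (fun t ht => hR t (hKt.trans ht)) x
  have jF := (integrable_tail_div F (G.restrict (Set.Ioc 0 K)) x)
  have jG := (integrable_tail_div G (G.restrict (Set.Ioc 0 K)) x)
  have jR := (integrable_tail_div R (G.restrict (Set.Ioc 0 K)) x)
  have h1 : ∫ y in Set.Ioc 0 K, tail R (x / y) ∂G ≤ κ * ((μ + η / 2) * tailSum F G x) := by
    have h2 : ∫ y in Set.Ioc 0 K, tail R (x / y) ∂G
        ≤ ∫ y in Set.Ioc 0 K, κ * (tail F (x / y) + tail G (x / y)) ∂G := by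
      refine setIntegral_mono_on jR ((jF.add jG).const_mul _) measurableSet_Ioc fun y hy => ?_
      refine hR (x / y) ?_
      rw [le_div_iff₀ hy.1]
      rcases le_or_gt t₀ 0 with h0 | h0
      · exact (mul_nonpos_of_nonpos_of_nonneg h0 hy.1.le).trans hx0.le
      · rw [mul_comm]
        exact (mul_le_mul_of_nonneg_right hy.2 h0.le).trans hxt
    rw [integral_const_mul, integral_add jF jG] at h2
    refine h2.trans (mul_le_mul_of_nonneg_left ?_ hκ)
    have k1 := mul_le_mul_of_nonneg_right hmKle (tail_nonneg F x)
    have k2 := mul_le_mul_of_nonneg_right hmKle (tail_nonneg G x)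
    have hq' : tailSum F G x = tail F x + tail G x := rfl
    rw [hq'] at i1 i2 ⊢
    linarith [(abs_le.1 i1).2, (abs_le.1 i2).2]
  have h2 : ∫ z in Set.Ioc 0 K, tail G (x / z) ∂(R) ≤ (K ^ α + 1) * tailSum F G x := by
    have h3 : ∫ z in Set.Ioc 0 K, tail G (x / z) ∂(R)
        ≤ ∫ z in Set.Ioc 0 K, (K ^ α + 1) * tailSum F G x ∂(R) := by
      refine setIntegral_mono_on (integrable_tail_div G _ x) (integrable_const _)
        measurableSet_Ioc fun z hz => ?_
      exact ((tail_antitone G (div_le_div_of_nonneg_left hx0.le hz.1 hz.2)).trans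
        (tail_right_le _)).trans hd
    refine h3.trans ?_
    rw [setIntegral_const, smul_eq_mul]
    exact mul_le_of_le_one_left (by positivity) measureReal_le_one
  rw [tail_mconv_eq hG hK hxK]
  have h3 := hbl.trans (mul_le_mul_of_nonneg_left n hκ)
  have hq' : tailSum F G x = tail F x + tail G x := rfl
  rw [← hq'] at h3
  linarith

/-- A tail of the order of the common scale entails a finite moment of order `α`. -/
theorem RegPair.integrable_posPow_of_tail_le [IsProbabilityMeasure F] [IsProbabilityMeasure G]
    (hp : RegPair α F G) {U : Measure ℝ} [IsProbabilityMeasure U] {C : ℝ} (hC : 0 ≤ C)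
    (h : ∀ᶠ x in atTop, tail U x ≤ C * tailSum F G x) : Integrable (posPow α) U := by
  obtain ⟨x₀, hx₀⟩ := eventually_atTop.1 h
  set c := posPow α x₀ with hc
  have hc0 : 0 ≤ c := posPow_nonneg _ _
  have h1 := lintegral_le_of_tail_le (U := U) (V := F + G) (κ := ENNReal.ofReal C) (a := x₀)
    (g := fun z => posPow α z - c) (fun x hx => by
      rw [← ofReal_tail, ← ofReal_tail, ← ENNReal.ofReal_mul hC, tail_add_measure]
      exact ENNReal.ofReal_le_ofReal (hx₀ x hx))
    (fun x y hxy => sub_le_sub_right (posPow_monotone hp.nonneg hxy) _)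
    (fun t ht => by
      simp_rw [lt_sub_iff_add_lt]
      exact isOpen_lt_posPow α (add_nonneg ht hc0))
    (fun x hx => sub_nonpos.2 (posPow_monotone hp.nonneg hx))
  have hi : Integrable (posPow α) (F + G) := integrable_add_measure.2 ⟨hp.intF, hp.intG⟩
  have h2 : ∫⁻ z, ENNReal.ofReal (posPow α z - c) ∂(F + G) < ⊤ :=
    lt_of_le_of_lt (lintegral_mono fun z => ENNReal.ofReal_le_ofReal (sub_le_self _ hc0))
      ((hasFiniteIntegral_iff_ofReal (ae_of_all _ (posPow_nonneg α))).1 hi.2)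
  refine ⟨(measurable_posPow α).aestronglyMeasurable,
    (hasFiniteIntegral_iff_ofReal (ae_of_all _ (posPow_nonneg α))).2 ?_⟩
  calc ∫⁻ z, ENNReal.ofReal (posPow α z) ∂U
      ≤ ∫⁻ z, (ENNReal.ofReal (posPow α z - c) + ENNReal.ofReal c) ∂U :=
        lintegral_mono fun z => by
          refine le_trans (le_of_eq ?_) ENNReal.ofReal_add_le
          rw [sub_add_cancel]
    _ = ∫⁻ z, ENNReal.ofReal (posPow α z - c) ∂U + ENNReal.ofReal c := by
        rw [lintegral_add_right _ measurable_const]; simp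
    _ < ⊤ := ENNReal.add_lt_top.2
        ⟨h1.trans_lt (ENNReal.mul_lt_top ENNReal.ofReal_lt_top h2), ENNReal.ofReal_lt_top⟩

end Product

/-! ### The random affine recursion at the level of laws -/

section Recursion

variable {α : ℝ} {F G : Measure ℝ}

theorem TailWithin.congr {U V : Measure ℝ} {a b u : ℝ} (h : TailWithin F G U a b u)
    (hUV : ∀ x, 0 ≤ x → tail V x = tail U x) : TailWithin F G V a b u := by
  intro ε hε
  filter_upwards [h ε hε, eventually_ge_atTop 0] with x hx hx0
  rwa [hUV x hx0]

variable [IsProbabilityMeasure G]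

theorem lintegral_posPow_le_of_tail_le (hα : 0 ≤ α) {U V : Measure ℝ} [IsFiniteMeasure U]
    [IsFiniteMeasure V] (hUV : ∀ x, 0 ≤ x → tail U x ≤ tail V x) :
    ∫⁻ z, ENNReal.ofReal (posPow α z) ∂U ≤ ∫⁻ z, ENNReal.ofReal (posPow α z) ∂V := by
  have := lintegral_le_of_tail_le (U := U) (V := V) (κ := 1) (a := 0) (g := posPow α)
    (fun x hx => by
      rw [one_mul, ← ofReal_tail, ← ofReal_tail]
      exact ENNReal.ofReal_le_ofReal (hUV x hx))
    (posPow_monotone hα) (fun t ht => isOpen_lt_posPow α ht) (fun x hx => (posPow_eq_zero hx).le)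
  rwa [one_mul] at this

theorem integral_posPow_congr (hα : 0 ≤ α) {U V : Measure ℝ} [IsFiniteMeasure U]
    [IsFiniteMeasure V] (hUV : ∀ x, 0 ≤ x → tail U x = tail V x) :
    ∫ z, posPow α z ∂U = ∫ z, posPow α z ∂V := by
  rw [integral_eq_lintegral_of_nonneg_ae (ae_of_all _ (posPow_nonneg α))
      (measurable_posPow α).aestronglyMeasurable,
    integral_eq_lintegral_of_nonneg_ae (ae_of_all _ (posPow_nonneg α))
      (measurable_posPow α).aestronglyMeasurable]
  congr 1
  exact le_antisymm (lintegral_posPow_le_of_tail_le hα fun x hx => (hUV x hx).le)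
    (lintegral_posPow_le_of_tail_le hα fun x hx => (hUV x hx).ge)

theorem posPow_mul {y : ℝ} (hy : 0 < y) (z : ℝ) : posPow α (y * z) = posPow α y * posPow α z := by
  rcases le_or_gt z 0 with hz | hz
  · rw [posPow_eq_zero hz, posPow_eq_zero (mul_nonpos_of_nonneg_of_nonpos hy.le hz), mul_zero]
  · rw [posPow_eq_of_pos hz, posPow_eq_of_pos hy, posPow_eq_of_pos (mul_pos hy hz),
      Real.mul_rpow hy.le hz.le]

theorem ae_pos_of_measure_Iic {G : Measure ℝ} (hG : G (Set.Iic 0) = 0) : ∀ᵐ y ∂G, 0 < y := by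
  rw [ae_iff]
  convert hG using 2
  ext y
  simp

theorem integral_posPow_mconv (hG : G (Set.Iic 0) = 0) (R : Measure ℝ) [IsProbabilityMeasure R] :
    ∫ z, posPow α z ∂(G.mconv R) = (∫ y, posPow α y ∂G) * ∫ z, posPow α z ∂(R) := by
  unfold Measure.mconv
  rw [integral_map (by fun_prop) (measurable_posPow α).aestronglyMeasurable,
    ← integral_prod_mul]
  refine integral_congr_ae ?_
  filter_upwards [Measure.quasiMeasurePreserving_fst.ae (ae_pos_of_measure_Iic hG)] with p hp
  exact posPow_mul hp _

theorem integral_posPow_pos_of_integrable {U : Measure ℝ} (hU : Integrable (posPow α) U)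
    (h0 : U (Set.Ioi 0) ≠ 0) : 0 < ∫ z, posPow α z ∂U := by
  rw [integral_pos_iff_support_of_nonneg (posPow_nonneg α) hU]
  refine (pos_iff_ne_zero.2 h0).trans_le (measure_mono fun z hz => ?_)
  rw [Function.mem_support, posPow_eq_of_pos hz]
  exact (Real.rpow_pos_of_pos hz _).ne'

theorem RegPair.moment_pos (hp : RegPair α F G) (hG : G (Set.Iic 0) = 0) :
    0 < ∫ y, posPow α y ∂G := by
  refine integral_posPow_pos_of_integrable hp.intG fun h0 => ?_
  have h1 := measure_union_le (μ := G) (Set.Iic 0) (Set.Ioi 0)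
  rw [Set.Iic_union_Ioi, measure_univ, hG, h0, add_zero] at h1
  exact absurd h1 (by simp)

variable [IsProbabilityMeasure F]

theorem TailWithin.integrable_posPow (hp : RegPair α F G) {U : Measure ℝ} [IsProbabilityMeasure U]
    {a b u : ℝ} (ha : 0 ≤ a) (hb : 0 ≤ b) (hu : 0 ≤ u) (h : TailWithin F G U a b u) :
    Integrable (posPow α) U :=
  hp.integrable_posPow_of_tail_le (by positivity) (h.eventually_le ha hb)

/-- One step of the recursion `U ↦ law of Y * (X + Z)` where `Z` has law `U`. The error
contracts by the factor `E Y ^ α`. -/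
theorem RegPair.tailWithin_step (hp : RegPair α F G) (hG : G (Set.Iic 0) = 0) {U : Measure ℝ}
    [IsProbabilityMeasure U] {a b u : ℝ} (ha : 0 ≤ a) (hb : 0 ≤ b) (hu : 0 ≤ u)
    (h : TailWithin F G U a b u) :
    TailWithin F G (G.mconv (F.conv U)) ((∫ y, posPow α y ∂G) * (1 + a))
      ((∫ y, posPow α y ∂G) * b + ∫ z, posPow α z ∂(F.conv U)) ((∫ y, posPow α y ∂G) * u) := by
  have h1 := hp.tailWithin_conv ha hb hu h
  exact hp.tailWithin_mconv hG (h1.integrable_posPow hp (by positivity) hb hu) (by positivity) hb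
    hu h1

/-- The coefficient of `tail G` after `n` steps, in terms of the moments `m k` of the iterates. -/
noncomputable def momentCoeff (μ : ℝ) (m : ℕ → ℝ) (n : ℕ) : ℝ :=
  ∑ i ∈ Finset.Icc 1 n, μ ^ ((i : ℤ) - 2) * m (n - i + 1)

theorem momentCoeff_succ {μ : ℝ} (hμ : μ ≠ 0) (m : ℕ → ℝ) (n : ℕ) :
    momentCoeff μ m (n + 1) = μ * momentCoeff μ m n + μ⁻¹ * m (n + 1) := by
  unfold momentCoeff
  rw [← Finset.add_sum_Ioc_eq_sum_Icc (by omega : 1 ≤ n + 1), Finset.mul_sum, add_comm]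
  congr 1
  · refine Finset.sum_bij' (fun i _ => i - 1) (fun i _ => i + 1) ?_ ?_ ?_ ?_ ?_
    · intro i hi; simp only [Finset.mem_Ioc, Finset.mem_Icc] at *; omega
    · intro i hi; simp only [Finset.mem_Ioc, Finset.mem_Icc] at *; omega
    · intro i hi; simp only [Finset.mem_Ioc] at *; omega
    · intro i hi; simp
    · intro i hi
      simp only [Finset.mem_Ioc] at hi
      obtain ⟨k, rfl⟩ : ∃ k, i = k + 1 := ⟨i - 1, by omega⟩
      rw [← mul_assoc, ← zpow_one_add₀ hμ]
      congr 2
      · push_cast; omega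
      · omega
  · norm_num [zpow_neg]

theorem momentCoeff_nonneg {μ : ℝ} (hμ : 0 ≤ μ) {m : ℕ → ℝ} (hm : ∀ k, 0 ≤ m k) (n : ℕ) :
    0 ≤ momentCoeff μ m n :=
  Finset.sum_nonneg fun _ _ => mul_nonneg (zpow_nonneg hμ _) (hm _)

theorem coeffA_succ (μ : ℝ) (n : ℕ) : coeffA μ (n + 1) = μ * (1 + coeffA μ n) := by
  induction n with
  | zero => simp [coeffA]
  | succ k ih =>
    have h : ∀ j, coeffA μ (j + 1) = coeffA μ j + μ ^ (j + 1) := fun j => by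
      unfold coeffA
      rw [Finset.sum_Icc_succ_top (by omega)]
    have hk := h k
    rw [ih] at hk
    rw [h (k + 1), ih]
    linear_combination (-μ) * hk

theorem coeffA_nonneg {μ : ℝ} (hμ : 0 ≤ μ) (n : ℕ) : 0 ≤ coeffA μ n :=
  Finset.sum_nonneg fun _ _ => pow_nonneg hμ _

theorem coeffA_pos {μ : ℝ} (hμ : 0 < μ) {n : ℕ} (hn : 1 ≤ n) : 0 < coeffA μ n :=
  Finset.sum_pos (fun _ _ => pow_pos hμ _) ⟨1, by simp [hn]⟩

theorem RegPair.tailWithin_iterate (hp : RegPair α F G) (hG : G (Set.Iic 0) = 0)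
    {U : ℕ → Measure ℝ} [∀ n, IsProbabilityMeasure (U n)] (h0 : ∀ x, 0 ≤ x → tail (U 0) x = 0)
    (hU : ∀ n x, 0 ≤ x → tail (U (n + 1)) x = tail (G.mconv (F.conv (U n))) x) (n : ℕ) :
    TailWithin F G (U n) (coeffA (∫ y, posPow α y ∂G) n)
      (momentCoeff (∫ y, posPow α y ∂G) (fun k => ∫ z, posPow α z ∂(U k)) n) 0 := by
  set μ := ∫ y, posPow α y ∂G with hμ
  have hμ0 : 0 < μ := hp.moment_pos hG
  induction n with
  | zero =>
    intro ε hε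
    filter_upwards [eventually_ge_atTop 0] with x hx
    rw [h0 x hx]
    simpa [coeffA, momentCoeff] using mul_nonneg hε.le (tailSum_nonneg (F := F) (G := G) x)
  | succ k ih =>
    have h1 := hp.tailWithin_step hG (coeffA_nonneg hμ0.le k)
      (momentCoeff_nonneg hμ0.le (fun j => integral_nonneg (posPow_nonneg α)) k) le_rfl ih
    have h2 : ∫ z, posPow α z ∂(U (k + 1)) = μ * ∫ z, posPow α z ∂(F.conv (U k)) := by
      rw [integral_posPow_congr hp.nonneg (hU k), integral_posPow_mconv hG]
    rw [coeffA_succ, momentCoeff_succ hμ0.ne', h2, inv_mul_cancel_left₀ hμ0.ne']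
    rw [mul_zero] at h1
    exact h1.congr (hU k)

/-- When `E Y ^ α < 1`, the tails of all iterates are bounded by one multiple of the common
scale. The levels below the threshold of the uniform estimates are covered by enlarging the
constant, so that the threshold does not move along the induction. -/
theorem RegPair.exists_uniform_tail_bound (hp : RegPair α F G) (hG : G (Set.Iic 0) = 0)
    (hμ : ∫ y, posPow α y ∂G < 1) {U : ℕ → Measure ℝ} [∀ n, IsProbabilityMeasure (U n)]
    (h0 : ∀ x, 0 ≤ x → tail (U 0) x = 0)
    (hU : ∀ n x, 0 ≤ x → tail (U (n + 1)) x = tail (G.mconv (F.conv (U n))) x) :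
    ∃ κ, 0 ≤ κ ∧ ∀ n x, 0 ≤ x → tail (U n) x ≤ κ * tailSum F G x := by
  set μ := ∫ y, posPow α y ∂G with hμd
  have hμ0 : 0 < μ := hp.moment_pos hG
  obtain ⟨η, hη, hθ⟩ : ∃ η, 0 < η ∧ (μ + η) * (1 + η) < 1 := by
    have h1 : Tendsto (fun η : ℝ => (μ + η) * (1 + η)) (𝓝[>] 0) (𝓝 ((μ + 0) * (1 + 0))) :=
      tendsto_nhdsWithin_of_tendsto_nhds (Continuous.tendsto (by fun_prop) _)
    obtain ⟨η, h2, h3⟩ := ((h1.eventually_lt_const (u := 1) (by simpa using hμ)).and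
      self_mem_nhdsWithin).exists
    exact ⟨η, h3, h2⟩
  obtain ⟨t₀, ht₀, hconv⟩ := hp.tail_conv_le_uniform hη
  obtain ⟨C, x₀, hC, hmul⟩ := hp.tail_mconv_le_uniform hG hη t₀
  set θ := (μ + η) * (1 + η) with hθd
  have hθ0 : 0 < θ := by positivity
  have hx₀ := hp.tailSum_pos x₀
  set κ := max ((θ + C) / (1 - θ)) (tailSum F G x₀)⁻¹ with hκ
  have hκ0 : 0 ≤ κ := le_max_of_le_right (inv_pos.2 hx₀).le
  refine ⟨κ, hκ0, fun n => ?_⟩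
  induction n with
  | zero =>
    intro x hx
    rw [h0 x hx]
    exact mul_nonneg hκ0 (tailSum_nonneg _)
  | succ k ih =>
    intro x hx
    rcases le_or_gt x₀ x with h | h
    · rw [hU k x hx]
      have h1 := hconv (U k) κ hκ0 ih
      refine (hmul (F.conv (U k)) _ (by positivity) h1 x h).trans ?_
      refine mul_le_mul_of_nonneg_right ?_ (tailSum_nonneg _)
      have h2 : (θ + C) / (1 - θ) ≤ κ := le_max_left _ _
      rw [div_le_iff₀ (by linarith)] at h2
      calc (μ + η) * ((1 + η) * κ + (1 + η)) + C = θ * κ + (θ + C) := by rw [hθd]; ring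
        _ ≤ κ := by linarith
    · calc tail (U (k + 1)) x ≤ 1 := tail_le_one _ _
        _ = (tailSum F G x₀)⁻¹ * tailSum F G x₀ := (inv_mul_cancel₀ hx₀.ne').symm
        _ ≤ κ * tailSum F G x :=
          mul_le_mul (le_max_right _ _) (tailSum_antitone h.le) hx₀.le hκ0

/-- A law that the recursion preserves on `[0, ∞)`, with a tail of the order of the common scale,
has the tail that the recursion predicts: the error contracts geometrically. -/
theorem RegPair.tailWithin_fixedPoint (hp : RegPair α F G) (hG : G (Set.Iic 0) = 0)
    (hμ : ∫ y, posPow α y ∂G < 1) {U : Measure ℝ} [IsProbabilityMeasure U] {κ : ℝ} (hκ : 0 ≤ κ)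
    (hb : ∀ x, 0 ≤ x → tail U x ≤ κ * tailSum F G x)
    (hU : ∀ x, 0 ≤ x → tail U x = tail (G.mconv (F.conv U)) x) :
    TailWithin F G U (coeffAinf (∫ y, posPow α y ∂G))
      ((∫ z, posPow α z ∂U) / ((∫ y, posPow α y ∂G) * (1 - ∫ y, posPow α y ∂G))) 0 := by
  set μ := ∫ y, posPow α y ∂G with hμd
  have hμ0 : 0 < μ := hp.moment_pos hG
  have hμ1 : 0 < 1 - μ := by linarith
  set ρ := ∫ z, posPow α z ∂(F.conv U) with hρ
  have hρ0 : 0 ≤ ρ := integral_nonneg (posPow_nonneg α)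
  have hm : ∫ z, posPow α z ∂U = μ * ρ := by
    rw [integral_posPow_congr hp.nonneg hU, integral_posPow_mconv hG]
  have hB : (∫ z, posPow α z ∂U) / (μ * (1 - μ)) = ρ / (1 - μ) := by
    rw [hm, mul_div_mul_left _ _ hμ0.ne']
  rw [hB]
  set A := coeffAinf μ with hA
  set B := ρ / (1 - μ) with hBd
  have hA0 : 0 ≤ A := div_nonneg hμ0.le hμ1.le
  have hB0 : 0 ≤ B := div_nonneg hρ0 hμ1.le
  have fA : μ * (1 + A) = A := by
    rw [hA, coeffAinf]; field_simp; ring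
  have fB : μ * B + ρ = B := by
    rw [hBd]; field_simp; ring
  have h0 : TailWithin F G U A B (κ + A + B) := by
    intro ε hε
    filter_upwards [eventually_ge_atTop 0] with x hx
    have h1 := hb x hx
    have h2 := mul_le_mul_of_nonneg_left (tail_left_le (F := F) (G := G) x) hA0
    have h3 := mul_le_mul_of_nonneg_left (tail_right_le (F := F) (G := G) x) hB0
    have h4 := tail_nonneg U x
    have h5 := mul_nonneg hA0 (tail_nonneg F x)
    have h6 := mul_nonneg hB0 (tail_nonneg G x)
    have h7 := mul_nonneg hε.le (tailSum_nonneg (F := F) (G := G) x)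
    have h8 := mul_nonneg hκ (tailSum_nonneg (F := F) (G := G) x)
    rw [abs_le]
    constructor <;> linarith
  have hit : ∀ k : ℕ, TailWithin F G U A B (μ ^ k * (κ + A + B)) := by
    intro k
    induction k with
    | zero => simpa using h0
    | succ k ih =>
      have h1 := hp.tailWithin_step hG hA0 hB0 (by positivity) ih
      rw [← hμd, ← hρ, fA, fB, ← mul_assoc, ← pow_succ'] at h1
      exact h1.congr hU
  intro ε hε
  have hlim : Tendsto (fun k : ℕ => μ ^ k * (κ + A + B)) atTop (𝓝 0) := by
    simpa using (tendsto_pow_atTop_nhds_zero_of_lt_one hμ0.le hμ).mul_const (κ + A + B)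
  obtain ⟨k, hk⟩ := (hlim.eventually_le_const (half_pos hε)).exists
  filter_upwards [hit k (ε / 2) (half_pos hε)] with x hx
  refine hx.trans (mul_le_mul_of_nonneg_right ?_ (tailSum_nonneg _))
  linarith

/-- If `Y * (X + Z)` is almost surely nonpositive, then `X` is bounded above. -/
theorem eventually_tail_left_eq_zero (hG : G (Set.Iic 0) = 0) {U : Measure ℝ}
    [IsProbabilityMeasure U] (h : tail (G.mconv (F.conv U)) 0 = 0) : ∀ᶠ x in atTop, tail F x = 0 := by
  have h1 : (1 : ℝ) * tail (F.conv U) 0 ≤ 0 := by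
    have hG1 : G.real (Set.Ioi 0) = 1 := by
      rw [← Set.compl_Iic, probReal_compl_eq_one_sub measurableSet_Iic, measureReal_def, hG]
      simp
    refine le_trans ?_ h.le
    rw [tail_mconv_eq_prod, ← hG1, tail, ← measureReal_prod_prod]
    exact measureReal_mono fun p hp => show 0 < p.1 * p.2 from mul_pos hp.1 hp.2
  filter_upwards [(tendsto_Iic_neg_mul U one_pos).eventually_lt_const one_pos] with x hx
  have h2 : tail F x * U.real (Set.Ioi (-x)) ≤ tail (F.conv U) 0 := by
    rw [tail_conv_eq_prod, tail, ← measureReal_prod_prod]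
    refine measureReal_mono fun p hp => ?_
    have h3 : x < p.1 := hp.1
    have h4 : -x < p.2 := hp.2
    change 0 < p.1 + p.2
    linarith
  have h3 : 0 < U.real (Set.Ioi (-x)) := by
    rw [← Set.compl_Iic, probReal_compl_eq_one_sub measurableSet_Iic]
    rw [one_mul] at hx
    linarith
  have h4 : tail F x * U.real (Set.Ioi (-x)) ≤ 0 := by linarith
  exact le_antisymm (nonpos_of_mul_nonpos_left h4 h3) (tail_nonneg _ _)

/-- If the coefficient of `tail G` vanishes, both sides vanish eventually; otherwise the right-hand
side is of the order of the common scale. -/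
theorem TailWithin.isEquivalent (hp : RegPair α F G) (hG : G (Set.Iic 0) = 0) {U V : Measure ℝ}
    [IsProbabilityMeasure U] [IsProbabilityMeasure V] {a b : ℝ} (h : TailWithin F G U a b 0)
    (ha : 0 < a) (hb : 0 ≤ b) (hV : ∀ x, 0 ≤ x → tail U x = tail (G.mconv (F.conv V)) x)
    (hb0 : b = 0 → ∫ z, posPow α z ∂U = 0) :
    tail U ~[atTop] fun x => a * tail F x + b * tail G x := by
  rcases hb.eq_or_lt with hb1 | hb1
  · have hi : Integrable (posPow α) U := h.integrable_posPow hp ha.le hb le_rfl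
    have h0 : tail U 0 = 0 := by
      by_contra hc
      refine (integral_posPow_pos_of_integrable hi fun h1 => hc ?_).ne' (hb0 hb1.symm)
      rw [tail, measureReal_def, h1, ENNReal.toReal_zero]
    have hF := eventually_tail_left_eq_zero (F := F) hG ((hV 0 le_rfl).symm.trans h0)
    refine (IsEquivalent.refl (u := fun _ : ℝ => (0 : ℝ))).congr_left ?_ |>.congr_right ?_
    · filter_upwards [eventually_ge_atTop 0] with x hx
      exact (le_antisymm ((tail_antitone U hx).trans h0.le) (tail_nonneg _ _)).symm
    · filter_upwards [hF] with x hx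
      simp [hx, ← hb1]
  · have hm : 0 < min a b := lt_min ha hb1
    refine IsLittleO.of_bound fun c hc => ?_
    filter_upwards [h (c * min a b) (mul_pos hc hm)] with x hx
    have hF := tail_nonneg F x
    have hG' := tail_nonneg G x
    rw [Pi.sub_apply, Real.norm_eq_abs, Real.norm_of_nonneg (by positivity)]
    refine hx.trans ?_
    rw [zero_add, mul_assoc]
    refine mul_le_mul_of_nonneg_left ?_ hc.le
    rw [tailSum, mul_add]
    exact add_le_add (mul_le_mul_of_nonneg_right (min_le_left _ _) hF)
      (mul_le_mul_of_nonneg_right (min_le_right _ _) hG')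

end Recursion

/-! ### Discounted sums and their maxima -/

section Pathwise

variable {Ω : Type*}

theorem S_zero (X Y : ℕ → Ω → ℝ) (ω : Ω) : S X Y 0 ω = 0 := by simp [S]

theorem S_succ (X Y : ℕ → Ω → ℝ) (n : ℕ) (ω : Ω) :
    S X Y (n + 1) ω
      = Y 0 ω * (X 0 ω + S (fun i => X (i + 1)) (fun i => Y (i + 1)) n ω) := by
  unfold S
  rw [Finset.sum_range_succ', mul_add, Finset.mul_sum, add_comm]
  congr 1
  · simp [mul_comm]
  · refine Finset.sum_congr rfl fun i _ => ?_
    rw [Finset.prod_range_succ' _ (i + 1)]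
    ring

theorem S_le_M (X Y : ℕ → Ω → ℝ) (n : ℕ) (ω : Ω) : S X Y n ω ≤ M X Y n ω :=
  Finset.le_sup' (fun k => S X Y k ω) (by simp)

theorem M_zero (X Y : ℕ → Ω → ℝ) (ω : Ω) : M X Y 0 ω = 0 := by simp [M, S_zero]

theorem M_monotone (X Y : ℕ → Ω → ℝ) (ω : Ω) : Monotone fun n => M X Y n ω := by
  intro m n hmn
  refine Finset.sup'_le _ _ fun k hk => ?_
  refine Finset.le_sup' (fun k => S X Y k ω) ?_
  simp only [Finset.mem_range] at hk ⊢
  omega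

theorem M_nonneg (X Y : ℕ → Ω → ℝ) (n : ℕ) (ω : Ω) : 0 ≤ M X Y n ω :=
  (M_zero X Y ω).ge.trans (M_monotone X Y ω (Nat.zero_le n))

theorem M_succ (X Y : ℕ → Ω → ℝ) (n : ℕ) {ω : Ω} (hY : 0 < Y 0 ω) :
    M X Y (n + 1) ω
      = max 0 (Y 0 ω * (X 0 ω + M (fun i => X (i + 1)) (fun i => Y (i + 1)) n ω)) := by
  apply le_antisymm
  · refine Finset.sup'_le _ _ fun k hk => ?_
    simp only [Finset.mem_range] at hk
    rcases k with _ | k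
    · rw [S_zero]
      exact le_max_left _ _
    · rw [S_succ]
      refine le_max_of_le_right (mul_le_mul_of_nonneg_left (add_le_add_right ?_ _) hY.le)
      exact (S_le_M _ _ _ _).trans (M_monotone _ _ _ (by omega))
  · refine max_le (M_nonneg _ _ _ _) ?_
    obtain ⟨k, hk, hk'⟩ := Finset.exists_mem_eq_sup' (Finset.nonempty_range_add_one (n := n))
      (fun k => S (fun i => X (i + 1)) (fun i => Y (i + 1)) k ω)
    have h1 : M (fun i => X (i + 1)) (fun i => Y (i + 1)) n ω
        = S (fun i => X (i + 1)) (fun i => Y (i + 1)) k ω := hk'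
    rw [h1, ← S_succ]
    refine (S_le_M _ _ _ _).trans (M_monotone _ _ _ ?_)
    simp only [Finset.mem_range] at hk
    omega

theorem tendsto_Minf_of_bddAbove {X Y : ℕ → Ω → ℝ} {ω : Ω} (h : BddAbove (Set.range fun n => M X Y n ω)) :
    Tendsto (fun n => M X Y n ω) atTop (𝓝 (Minf X Y ω)) :=
  tendsto_nhds_limUnder ⟨_, tendsto_atTop_ciSup (M_monotone X Y ω) h⟩

end Pathwise

/-! ### The probabilistic model -/

/-- The standing assumptions: `X` and `Y` are independent sequences of independent variables with
laws `F` and `G`. -/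
structure IIDModel {Ω : Type*} [MeasurableSpace Ω] (P : Measure Ω) (X Y : ℕ → Ω → ℝ)
    (F G : Measure ℝ) : Prop where
  measX : ∀ i, Measurable (X i)
  measY : ∀ i, Measurable (Y i)
  lawX : ∀ i, P.map (X i) = F
  lawY : ∀ i, P.map (Y i) = G
  indX : iIndepFun X P
  indY : iIndepFun Y P
  indXY : IndepFun (fun ω i => X i ω) (fun ω i => Y i ω) P

section Model

variable {Ω : Type*} [MeasurableSpace Ω] {P : Measure Ω}

theorem indepFun_zero_shift {X : ℕ → Ω → ℝ} (hm : ∀ i, Measurable (X i)) (h : iIndepFun X P) :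
    IndepFun (X 0) (fun ω i => X (i + 1) ω) P := by
  have h1 := indep_iSup_of_disjoint (m := fun i => MeasurableSpace.comap (X i) inferInstance)
    (fun i => (hm i).comap_le) h (S := {0}) (T := {0}ᶜ) disjoint_compl_right
  rw [IndepFun_iff_Indep]
  refine indep_of_indep_of_le_left (indep_of_indep_of_le_right h1 ?_) ?_
  · rw [MeasurableSpace.pi, MeasurableSpace.comap_iSup]
    refine iSup_le fun i => ?_
    rw [MeasurableSpace.comap_comp]
    exact le_iSup₂ (f := fun i (_ : i ∈ ({0}ᶜ : Set ℕ)) => MeasurableSpace.comap (X i) inferInstance)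
      (i + 1) (by simp)
  · exact le_iSup₂ (f := fun i (_ : i ∈ ({0} : Set ℕ)) => MeasurableSpace.comap (X i) inferInstance)
      0 (by simp)

theorem map_shift_eq {X : ℕ → Ω → ℝ} {F : Measure ℝ} (hm : ∀ i, Measurable (X i))
    (hl : ∀ i, P.map (X i) = F) (h : iIndepFun X P) :
    P.map (fun ω i => X (i + 1) ω) = P.map (fun ω i => X i ω) := by
  have h2 : iIndepFun (fun i => X (i + 1)) P := h.precomp (add_left_injective 1)
  rw [h.map_fun_eq_infinitePi_map hm, h2.map_fun_eq_infinitePi_map fun i => hm (i + 1)]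
  simp_rw [hl]

theorem tail_map_eq {Z : Ω → ℝ} (hZ : AEMeasurable Z P) (x : ℝ) :
    tail (P.map Z) x = P.real {ω | x < Z ω} := by
  rw [tail, measureReal_def, Measure.map_apply_of_aemeasurable hZ measurableSet_Ioi]
  rfl

theorem tail_map_max_zero {Z W : Ω → ℝ} (hZ : AEMeasurable Z P) (hW : AEMeasurable W P)
    (h : ∀ᵐ ω ∂P, W ω = max 0 (Z ω)) {x : ℝ} (hx : 0 ≤ x) :
    tail (P.map W) x = tail (P.map Z) x := by
  rw [tail_map_eq hZ, tail_map_eq hW]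
  refine measureReal_congr ?_
  filter_upwards [h] with ω hω
  apply propext
  change x < W ω ↔ x < Z ω
  rw [hω, lt_max_iff]
  simp [hx.not_gt]

theorem tail_map_zero {Z : Ω → ℝ} (hZ : ∀ ω, Z ω = 0) {x : ℝ} (hx : 0 ≤ x) :
    tail (P.map Z) x = 0 := by
  have : Z = fun _ => 0 := funext hZ
  rw [this, tail_map_eq aemeasurable_const]
  simp [hx.not_gt]

theorem IIDModel.ae_pos {X Y : ℕ → Ω → ℝ} {F G : Measure ℝ} (h : IIDModel P X Y F G) (hG : G (Set.Iic 0) = 0) :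
    ∀ᵐ ω ∂P, ∀ i, 0 < Y i ω := by
  refine ae_all_iff.2 fun i => ?_
  have h1 := ae_pos_of_measure_Iic hG
  rw [← h.lawY i] at h1
  exact ae_of_ae_map (h.measY i).aemeasurable h1

variable [IsProbabilityMeasure P]

theorem map_zero_shift_eq {X : ℕ → Ω → ℝ} {F : Measure ℝ} (hm : ∀ i, Measurable (X i))
    (hl : ∀ i, P.map (X i) = F) (h : iIndepFun X P) :
    P.map (fun ω => (X 0 ω, fun i => X (i + 1) ω)) = F.prod (P.map (fun ω i => X i ω)) := by
  rw [(indepFun_iff_map_prod_eq_prod_map_map (hm 0).aemeasurable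
    (measurable_pi_lambda _ fun i => hm (i + 1)).aemeasurable).1 (indepFun_zero_shift hm h), hl,
    map_shift_eq hm hl h]

variable {X Y : ℕ → Ω → ℝ} {F G : Measure ℝ}

theorem IIDModel.isProbabilityMeasure_left (h : IIDModel P X Y F G) : IsProbabilityMeasure F := by
  rw [← h.lawX 0]
  exact Measure.isProbabilityMeasure_map (h.measX 0).aemeasurable

theorem IIDModel.isProbabilityMeasure_right (h : IIDModel P X Y F G) : IsProbabilityMeasure G := by
  rw [← h.lawY 0]
  exact Measure.isProbabilityMeasure_map (h.measY 0).aemeasurable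

/-- For a functional `Z` of the two sequences, the law of `Y₀ * (X₀ + Z')`, with `Z'` the same
functional of the shifted sequences, arises from that of `Z` by one step of the recursion. -/
theorem IIDModel.map_mul_add (h : IIDModel P X Y F G) {q : (ℕ → ℝ) × (ℕ → ℝ) → ℝ}
    (hq : Measurable q) :
    P.map (fun ω => Y 0 ω * (X 0 ω + q (fun i => X (i + 1) ω, fun i => Y (i + 1) ω)))
      = G.mconv (F.conv (P.map fun ω => q (fun i => X i ω, fun i => Y i ω))) := by
  have := h.isProbabilityMeasure_left
  have := h.isProbabilityMeasure_right
  have mX : Measurable fun ω i => X i ω := measurable_pi_lambda _ h.measX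
  have mY : Measurable fun ω i => Y i ω := measurable_pi_lambda _ h.measY
  have mX' : Measurable fun ω i => X (i + 1) ω := measurable_pi_lambda _ fun i => h.measX (i + 1)
  have mY' : Measurable fun ω i => Y (i + 1) ω := measurable_pi_lambda _ fun i => h.measY (i + 1)
  have mX0 := h.measX 0
  have mY0 := h.measY 0
  set LX := P.map fun ω i => X i ω with hLX
  set LY := P.map fun ω i => Y i ω with hLY
  have : IsProbabilityMeasure LX := Measure.isProbabilityMeasure_map mX.aemeasurable
  have : IsProbabilityMeasure LY := Measure.isProbabilityMeasure_map mY.aemeasurable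
  have hsplit : Measurable fun x : ℕ → ℝ => (x 0, fun i => x (i + 1)) := by fun_prop
  have hind : IndepFun (fun ω => (X 0 ω, fun i => X (i + 1) ω))
      (fun ω => (Y 0 ω, fun i => Y (i + 1) ω)) P := h.indXY.comp hsplit hsplit
  have hbase : MeasurePreserving (fun ω => ((X 0 ω, fun i => X (i + 1) ω),
      (Y 0 ω, fun i => Y (i + 1) ω))) P ((F.prod LX).prod (G.prod LY)) := by
    have m1 := mX0.prodMk mX'
    have m2 := mY0.prodMk mY'
    refine ⟨m1.prodMk m2, ?_⟩
    rw [(indepFun_iff_map_prod_eq_prod_map_map m1.aemeasurable m2.aemeasurable).1 hind,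
      map_zero_shift_eq h.measX h.lawX h.indX, map_zero_shift_eq h.measY h.lawY h.indY]
  have hlaw : P.map (fun ω => q (fun i => X i ω, fun i => Y i ω)) = (LX.prod LY).map q := by
    rw [← (indepFun_iff_map_prod_eq_prod_map_map mX.aemeasurable mY.aemeasurable).1 h.indXY,
      Measure.map_map hq (mX.prodMk mY)]
    rfl
  -- rearrangement of the four independent components
  have hin : MeasurePreserving
      (fun p : (ℕ → ℝ) × (ℝ × (ℕ → ℝ)) => (p.2.1, q (p.2.2, p.1)))
      (LY.prod (F.prod LX)) (F.prod ((LX.prod LY).map q)) := by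
    have h1 : MeasurePreserving (Prod.swap : (ℕ → ℝ) × (ℝ × (ℕ → ℝ)) → _)
        (LY.prod (F.prod LX)) ((F.prod LX).prod LY) := Measure.measurePreserving_swap
    have h2 := (measurePreserving_prodAssoc F LX LY).comp h1
    exact ((MeasurePreserving.id F).prod (hq.measurePreserving (LX.prod LY))).comp h2
  have hall : MeasurePreserving
      (fun p : (ℝ × (ℕ → ℝ)) × (ℝ × (ℕ → ℝ)) => (p.2.1, (p.1.1, q (p.1.2, p.2.2))))
      ((F.prod LX).prod (G.prod LY)) (G.prod (F.prod ((LX.prod LY).map q))) := by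
    have h1 : MeasurePreserving (Prod.swap : (ℝ × (ℕ → ℝ)) × (ℝ × (ℕ → ℝ)) → _)
        ((F.prod LX).prod (G.prod LY)) ((G.prod LY).prod (F.prod LX)) :=
      Measure.measurePreserving_swap
    have h2 := (measurePreserving_prodAssoc G LY (F.prod LX)).comp h1
    exact ((MeasurePreserving.id G).prod hin).comp h2
  have hfin := (hall.comp hbase).map_eq
  have : IsProbabilityMeasure ((LX.prod LY).map q) :=
    Measure.isProbabilityMeasure_map hq.aemeasurable
  rw [hlaw]
  unfold Measure.mconv Measure.conv
  have hadd : G.prod ((F.prod ((LX.prod LY).map q)).map fun p => p.1 + p.2)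
      = (G.prod (F.prod ((LX.prod LY).map q))).map
        (Prod.map id fun p : ℝ × ℝ => p.1 + p.2) := by
    rw [← Measure.map_prod_map _ _ measurable_id (by fun_prop), Measure.map_id]
  rw [hadd, ← hfin, Measure.map_map (by fun_prop) (by fun_prop),
    Measure.map_map (by fun_prop) (hall.measurable.comp hbase.measurable)]
  rfl

theorem measurable_S {X Y : ℕ → Ω → ℝ} (hX : ∀ i, Measurable (X i)) (hY : ∀ i, Measurable (Y i))
    (n : ℕ) : Measurable (S X Y n) := by
  unfold S
  fun_prop

theorem measurable_M {X Y : ℕ → Ω → ℝ} (hX : ∀ i, Measurable (X i)) (hY : ∀ i, Measurable (Y i))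
    (n : ℕ) : Measurable (M X Y n) := by
  have h : M X Y n = (Finset.range (n + 1)).sup' Finset.nonempty_range_add_one
      (fun k => S X Y k) := by
    ext ω
    rw [Finset.sup'_apply]
    rfl
  rw [h]
  exact Finset.measurable_sup' _ fun k _ => measurable_S hX hY k

theorem measurable_Sinf {X Y : ℕ → Ω → ℝ} (hX : ∀ i, Measurable (X i))
    (hY : ∀ i, Measurable (Y i)) : Measurable (Sinf X Y) :=
  (StronglyMeasurable.limUnder fun n => (measurable_S hX hY n).stronglyMeasurable).measurable

theorem measurable_Minf {X Y : ℕ → Ω → ℝ} (hX : ∀ i, Measurable (X i))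
    (hY : ∀ i, Measurable (Y i)) : Measurable (Minf X Y) :=
  (StronglyMeasurable.limUnder fun n => (measurable_M hX hY n).stronglyMeasurable).measurable

theorem measurable_coord_fst (i : ℕ) : Measurable fun p : (ℕ → ℝ) × (ℕ → ℝ) => p.1 i := by fun_prop

theorem measurable_coord_snd (i : ℕ) : Measurable fun p : (ℕ → ℝ) × (ℕ → ℝ) => p.2 i := by fun_prop

theorem IIDModel.map_S_succ (h : IIDModel P X Y F G) (n : ℕ) :
    P.map (S X Y (n + 1)) = G.mconv (F.conv (P.map (S X Y n))) := by
  have h1 := h.map_mul_add (measurable_S measurable_coord_fst measurable_coord_snd n)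
  rw [show S X Y (n + 1) = _ from funext (S_succ X Y n)]
  exact h1

theorem IIDModel.tail_map_M_succ (h : IIDModel P X Y F G) (hG : G (Set.Iic 0) = 0) (n : ℕ) {x : ℝ}
    (hx : 0 ≤ x) :
    tail (P.map (M X Y (n + 1))) x = tail (G.mconv (F.conv (P.map (M X Y n)))) x := by
  have h1 := h.map_mul_add (measurable_M measurable_coord_fst measurable_coord_snd n)
  have h2 : tail (P.map (M X Y (n + 1))) x = tail (P.map fun ω =>
      Y 0 ω * (X 0 ω + M (fun i => X (i + 1)) (fun i => Y (i + 1)) n ω)) x := by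
    refine tail_map_max_zero (Measurable.aemeasurable ?_) (measurable_M h.measX h.measY _).aemeasurable
      ?_ hx
    · exact (h.measY 0).mul ((h.measX 0).add
        (measurable_M (fun i => h.measX (i + 1)) (fun i => h.measY (i + 1)) n))
    · filter_upwards [h.ae_pos hG] with ω hω
      exact M_succ X Y n (hω 0)
  rw [h2]
  exact congrArg (fun U => tail U x) h1

/-! ### Almost sure convergence -/

theorem IIDModel.measureReal_exists_lt_M_le (h : IIDModel P X Y F G) {κ : ℝ}
    (hκ : ∀ n x, 0 ≤ x → tail (P.map (M X Y n)) x ≤ κ * tailSum F G x) {x : ℝ} (hx : 0 ≤ x) :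
    P.real {ω | ∃ n, x < M X Y n ω} ≤ κ * tailSum F G x := by
  have h1 : {ω | ∃ n, x < M X Y n ω} = ⋃ n, {ω | x < M X Y n ω} := by
    ext ω; simp
  have h2 : Monotone fun n => {ω | x < M X Y n ω} := fun m n hmn ω (hω : x < M X Y m ω) =>
    lt_of_lt_of_le hω (M_monotone X Y ω hmn)
  have h3 := tendsto_measure_iUnion_atTop (μ := P) h2
  have h4 := (ENNReal.tendsto_toReal (measure_ne_top _ _)).comp h3
  rw [h1]
  refine le_of_tendsto' h4 fun n => ?_
  have h5 := hκ n x hx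
  rwa [tail_map_eq (measurable_M h.measX h.measY n).aemeasurable] at h5

/-- A uniform bound on the tails of the maxima makes them almost surely bounded. -/
theorem IIDModel.ae_bddAbove_M (h : IIDModel P X Y F G) {κ : ℝ}
    (hκ : ∀ n x, 0 ≤ x → tail (P.map (M X Y n)) x ≤ κ * tailSum F G x) :
    ∀ᵐ ω ∂P, BddAbove (Set.range fun n => M X Y n ω) := by
  have := h.isProbabilityMeasure_left
  have := h.isProbabilityMeasure_right
  have h1 : ∀ x, 0 ≤ x → P.real {ω | ¬ BddAbove (Set.range fun n => M X Y n ω)}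
      ≤ κ * tailSum F G x := by
    intro x hx
    refine (measureReal_mono fun ω hω => ?_).trans (h.measureReal_exists_lt_M_le hκ hx)
    by_contra hc
    refine hω ⟨x, ?_⟩
    rintro _ ⟨n, rfl⟩
    by_contra hn
    exact hc ⟨n, not_le.1 hn⟩
  have h2 : Tendsto (fun x => κ * tailSum F G x) atTop (𝓝 0) := by
    simpa using (tailSum_tendsto_zero (F := F) (G := G)).const_mul κ
  have h3 := ge_of_tendsto h2 ((eventually_ge_atTop 0).mono h1)
  rw [ae_iff]
  exact (measureReal_eq_zero_iff).1 (le_antisymm h3 measureReal_nonneg)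

theorem IIDModel.tail_map_Minf (h : IIDModel P X Y F G) (hG : G (Set.Iic 0) = 0)
    (hb : ∀ᵐ ω ∂P, BddAbove (Set.range fun n => M X Y n ω)) {x : ℝ} (hx : 0 ≤ x) :
    tail (P.map (Minf X Y)) x = tail (G.mconv (F.conv (P.map (Minf X Y)))) x := by
  have h1 := h.map_mul_add (measurable_Minf measurable_coord_fst measurable_coord_snd)
  have h2 : tail (P.map (Minf X Y)) x = tail (P.map fun ω =>
      Y 0 ω * (X 0 ω + Minf (fun i => X (i + 1)) (fun i => Y (i + 1)) ω)) x := by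
    refine tail_map_max_zero (Measurable.aemeasurable ?_) (measurable_Minf h.measX h.measY).aemeasurable
      ?_ hx
    · exact (h.measY 0).mul ((h.measX 0).add
        (measurable_Minf (fun i => h.measX (i + 1)) (fun i => h.measY (i + 1))))
    · filter_upwards [h.ae_pos hG, hb] with ω hω hbω
      -- boundedness is inherited by the shifted sequence
      have hb' : BddAbove (Set.range fun n => M (fun i => X (i + 1)) (fun i => Y (i + 1)) n ω) := by
        obtain ⟨B, hB⟩ := hbω
        refine ⟨B / Y 0 ω - X 0 ω, ?_⟩
        rintro _ ⟨n, rfl⟩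
        have h3 : M X Y (n + 1) ω ≤ B := hB ⟨n + 1, rfl⟩
        rw [M_succ X Y n (hω 0)] at h3
        have h4 := (le_max_right _ _).trans h3
        simp only
        rw [le_sub_iff_add_le, le_div_iff₀' (hω 0), add_comm]
        exact h4
      have t1 := (tendsto_Minf_of_bddAbove hbω).comp (tendsto_add_atTop_nat 1)
      have t2 := (tendsto_const_nhds (x := (0 : ℝ))).max
        (((tendsto_Minf_of_bddAbove hb').const_add (X 0 ω)).const_mul (Y 0 ω))
      refine tendsto_nhds_unique t1 (t2.congr fun n => ?_)
      exact (M_succ X Y n (hω 0)).symm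
  rw [h2]
  exact congrArg (fun U => tail U x) h1

theorem IIDModel.map_Sinf (h : IIDModel P X Y F G) (hG : G (Set.Iic 0) = 0)
    (hc : ∀ᵐ ω ∂P, Tendsto (fun n => S X Y n ω) atTop (𝓝 (Sinf X Y ω))) :
    P.map (Sinf X Y) = G.mconv (F.conv (P.map (Sinf X Y))) := by
  have h1 := h.map_mul_add (measurable_Sinf measurable_coord_fst measurable_coord_snd)
  refine Eq.trans (Measure.map_congr ?_) h1
  filter_upwards [h.ae_pos hG, hc] with ω hω hcω
  have t1 := hcω.comp (tendsto_add_atTop_nat 1)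
  have t2 : Tendsto (fun n => S (fun i => X (i + 1)) (fun i => Y (i + 1)) n ω) atTop
      (𝓝 ((Y 0 ω)⁻¹ * Sinf X Y ω - X 0 ω)) := by
    refine ((t1.const_mul (Y 0 ω)⁻¹).sub_const (X 0 ω)).congr fun n => ?_
    simp only [Function.comp_apply]
    rw [S_succ, inv_mul_cancel_left₀ (hω 0).ne']
    ring
  have t3 : Sinf (fun i => X (i + 1)) (fun i => Y (i + 1)) ω = (Y 0 ω)⁻¹ * Sinf X Y ω - X 0 ω :=
    t2.limUnder_eq
  change Sinf X Y ω = Y 0 ω * (X 0 ω + Sinf (fun i => X (i + 1)) (fun i => Y (i + 1)) ω)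
  rw [t3, add_sub_cancel, mul_inv_cancel_left₀ (hω 0).ne']

theorem tail_map_le_of_forall_lt {Z : Ω → ℝ} (hZ : AEMeasurable Z P) {x : ℝ}
    (h : ∀ᵐ ω ∂P, x < Z ω → ∃ n, x < M X Y n ω) :
    tail (P.map Z) x ≤ P.real {ω | ∃ n, x < M X Y n ω} := by
  rw [tail_map_eq hZ]
  exact ENNReal.toReal_mono (measure_ne_top _ _) (measure_mono_ae h)

end Model

section Convergence

variable {Ω : Type*} [MeasurableSpace Ω] {P : Measure Ω} {X Y : ℕ → Ω → ℝ} {F G : Measure ℝ} {α : ℝ}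

/-- Markov's inequality for the power `α` of the discount factors and the Borel–Cantelli lemma. -/
theorem IIDModel.ae_eventually_prod_le (h : IIDModel P X Y F G) (hp : RegPair α F G)
    (hG : G (Set.Iic 0) = 0) {ρ : ℝ} (hρ : 0 < ρ) (hμ : ∫ y, posPow α y ∂G < ρ ^ α) :
    ∀ᵐ ω ∂P, ∀ᶠ n in atTop, ∏ j ∈ Finset.range n, Y j ω ≤ ρ ^ n := by
  set μ := ∫ y, posPow α y ∂G with hμd
  have hμ0 : 0 ≤ μ := integral_nonneg fun y => posPow_nonneg _ _
  have hρα : 0 < ρ ^ α := Real.rpow_pos_of_pos hρ _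
  set f : ℕ → Ω → ENNReal := fun j ω => ENNReal.ofReal (posPow α (Y j ω)) with hf
  have hfm : ∀ j, Measurable (f j) := fun j => ((measurable_posPow α).comp (h.measY j)).ennreal_ofReal
  have hfi : iIndepFun f P :=
    h.indY.comp (fun _ z => ENNReal.ofReal (posPow α z)) fun _ => (measurable_posPow α).ennreal_ofReal
  have hf1 : ∀ j, ∫⁻ ω, f j ω ∂P = ENNReal.ofReal μ := by
    intro j
    rw [hμd, ofReal_integral_eq_lintegral_ofReal hp.intG (ae_of_all _ (posPow_nonneg α)),
      ← h.lawY j, lintegral_map (measurable_posPow α).ennreal_ofReal (h.measY j)]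
  set r := ENNReal.ofReal (μ / ρ ^ α) with hr
  have hbound : ∀ n, P {ω | ENNReal.ofReal (ρ ^ α) ^ n ≤ ∏ j ∈ Finset.range n, f j ω} ≤ r ^ n := by
    intro n
    have h1 := mul_meas_ge_le_lintegral (μ := P) (f := fun ω => ∏ j ∈ Finset.range n, f j ω)
      (Finset.measurable_prod _ fun j _ => hfm j) (ENNReal.ofReal (ρ ^ α) ^ n)
    rw [lintegral_prod_eq_prod_lintegral_of_indepFun _ f hfi hfm] at h1
    simp only [hf1, Finset.prod_const, Finset.card_range] at h1
    rw [hr, ← ENNReal.ofReal_pow (div_nonneg hμ0 hρα.le), div_pow,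
      ENNReal.ofReal_div_of_pos (pow_pos hρα n), ENNReal.ofReal_pow hμ0, ENNReal.ofReal_pow hρα.le,
      ENNReal.le_div_iff_mul_le (Or.inl (by simpa using fun h => absurd h hρα.not_ge))
        (Or.inl (ENNReal.pow_ne_top ENNReal.ofReal_ne_top)), mul_comm]
    exact h1
  have hr1 : r < 1 := by
    rw [hr, ENNReal.ofReal_lt_one, div_lt_one hρα]
    exact hμ
  have hsum : ∑' n, P {ω | ENNReal.ofReal (ρ ^ α) ^ n ≤ ∏ j ∈ Finset.range n, f j ω} ≠ ⊤ :=
    ne_top_of_le_ne_top (by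
      rw [ENNReal.tsum_geometric]
      exact ENNReal.inv_ne_top.2 (tsub_pos_of_lt hr1).ne') (ENNReal.tsum_le_tsum hbound)
  filter_upwards [ae_eventually_notMem hsum, h.ae_pos hG] with ω hω hY
  filter_upwards [hω] with n hn
  by_contra! hc
  refine hn ?_
  have h1 : ∏ j ∈ Finset.range n, f j ω
      = ENNReal.ofReal ((∏ j ∈ Finset.range n, Y j ω) ^ α) := by
    rw [← Real.finsetProd_rpow _ _ fun j _ => (hY j).le,
      ENNReal.ofReal_prod_of_nonneg fun j _ => Real.rpow_nonneg (hY j).le _]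
    exact Finset.prod_congr rfl fun j _ => by rw [hf]; simp only [posPow_eq_of_pos (hY j)]
  change ENNReal.ofReal (ρ ^ α) ^ n ≤ ∏ j ∈ Finset.range n, f j ω
  rw [h1, ← ENNReal.ofReal_pow hρα.le]
  refine ENNReal.ofReal_le_ofReal ?_
  rw [← Real.rpow_natCast (ρ ^ α), ← Real.rpow_mul hρ.le, mul_comm, Real.rpow_mul hρ.le,
    Real.rpow_natCast]
  exact Real.rpow_le_rpow (pow_nonneg hρ.le _) hc.le hp.nonneg

theorem RegPair.integrable_log_abs (hp : RegPair α F G) (hα : 0 < α)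
    (hint : Integrable (fun x : ℝ => Real.log (max (max (-x) 0) 1)) F) :
    Integrable (fun x : ℝ => Real.log (max |x| 1)) F := by
  refine (hint.add (hp.intF.div_const α)).mono' (Real.measurable_log.comp
    (by fun_prop : Measurable fun x : ℝ => max |x| 1)).aestronglyMeasurable (ae_of_all _ fun x => ?_)
  rw [Real.norm_of_nonneg (Real.log_nonneg (le_max_right _ _))]
  simp only [Pi.add_apply]
  have h0 : 0 ≤ posPow α x / α := div_nonneg (posPow_nonneg _ _) hα.le
  rcases le_or_gt x 0 with hx | hx
  · rw [abs_of_nonpos hx, max_eq_left (by linarith : 0 ≤ -x)]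
    linarith
  · rw [abs_of_pos hx, max_eq_right (by linarith : -x ≤ 0), max_eq_right zero_le_one, Real.log_one,
      zero_add]
    rcases le_or_gt x 1 with h1 | h1
    · rw [max_eq_right h1, Real.log_one]
      exact h0
    · rw [max_eq_left h1.le, posPow_eq_of_pos hx]
      exact Real.log_le_rpow_div hx.le hα

/-- An integrable logarithm keeps the increments below any exponential rate. -/
theorem IIDModel.ae_eventually_abs_le [IsProbabilityMeasure P] (h : IIDModel P X Y F G)
    (hint : Integrable (fun x : ℝ => Real.log (max |x| 1)) F) {s : ℝ} (hs : 1 < s) :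
    ∀ᵐ ω ∂P, ∀ᶠ n in atTop, |X n ω| ≤ s ^ n := by
  have hls : 0 < Real.log s := Real.log_pos hs
  set Z : ℝ → ℝ := fun x => Real.log (max |x| 1) / Real.log s with hZ
  have hZm : Measurable Z := by fun_prop
  have hi : Integrable (fun ω => Z (X 0 ω)) P := by
    have h1 : Integrable Z F := hint.div_const _
    rw [← h.lawX 0] at h1
    exact h1.comp_measurable (h.measX 0)
  have hsum := @tsum_prob_mem_Ioi_lt_top Ω (@MeasureSpace.mk Ω _ P) _ (fun ω => Z (X 0 ω)) hi
    fun ω => div_nonneg (Real.log_nonneg (le_max_right _ _)) hls.le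
  have hsum2 : ∑' n : ℕ, P {ω | Z (X n ω) ∈ Set.Ioi (n : ℝ)} ≠ ⊤ := by
    have h1 : ∀ n : ℕ, P {ω | Z (X n ω) ∈ Set.Ioi (n : ℝ)} = P {ω | Z (X 0 ω) ∈ Set.Ioi (n : ℝ)} := by
      intro n
      have h2 : ∀ i, P {ω | Z (X i ω) ∈ Set.Ioi (n : ℝ)} = F (Z ⁻¹' Set.Ioi (n : ℝ)) := fun i => by
        rw [← h.lawX i, Measure.map_apply (h.measX i) (hZm measurableSet_Ioi)]
        rfl
      rw [h2, h2]
    simp_rw [h1]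
    exact hsum.ne
  filter_upwards [ae_eventually_notMem hsum2] with ω hω
  filter_upwards [hω] with n hn
  have h1 : Z (X n ω) ≤ n := not_lt.1 hn
  rw [hZ] at h1
  simp only at h1
  rw [div_le_iff₀ hls, ← Real.log_pow] at h1
  exact (le_max_left _ _).trans
    ((Real.log_le_log_iff (by positivity) (by positivity)).1 h1)

/-- The discounted series converges absolutely: the discount factors decay at an exponential rate
which the increments do not reach. -/
theorem IIDModel.ae_tendsto_Sinf [IsProbabilityMeasure P] (h : IIDModel P X Y F G)
    (hp : RegPair α F G) (hα : 0 < α) (hG : G (Set.Iic 0) = 0) (hμ : ∫ y, posPow α y ∂G < 1)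
    (hint : Integrable (fun x : ℝ => Real.log (max (max (-x) 0) 1)) F) :
    ∀ᵐ ω ∂P, Tendsto (fun n => S X Y n ω) atTop (𝓝 (Sinf X Y ω)) := by
  obtain ⟨t, ⟨ht0, ht1⟩, htμ⟩ : ∃ t : ℝ, (0 < t ∧ t < 1) ∧ ∫ y, posPow α y ∂G < (t ^ 2) ^ α := by
    have h1 : Tendsto (fun t : ℝ => (t ^ 2) ^ α) (𝓝[<] 1) (𝓝 (((1 : ℝ) ^ 2) ^ α)) := by
      refine tendsto_nhdsWithin_of_tendsto_nhds (ContinuousAt.tendsto ?_)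
      exact ContinuousAt.rpow_const (by fun_prop) (Or.inl (by norm_num))
    obtain ⟨t, h2, h3⟩ := ((h1.eventually_const_lt (by simpa using hμ)).and
      (Ioo_mem_nhdsLT (show (0 : ℝ) < 1 by norm_num))).exists
    exact ⟨t, h3, h2⟩
  filter_upwards [h.ae_eventually_prod_le hp hG (pow_pos ht0 2) htμ,
    h.ae_eventually_abs_le (hp.integrable_log_abs hα hint) ((one_lt_inv₀ ht0).2 ht1),
    h.ae_pos hG] with ω h1 h2 hY
  have hsum : Summable fun i => X i ω * ∏ j ∈ Finset.range (i + 1), Y j ω := by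
    refine Summable.of_norm_bounded_eventually_nat
      ((summable_geometric_of_lt_one ht0.le ht1).mul_left (t ^ 2)) ?_
    filter_upwards [(tendsto_add_atTop_nat 1).eventually h1, h2] with n h3 h4
    have h5 : 0 ≤ ∏ j ∈ Finset.range (n + 1), Y j ω := Finset.prod_nonneg fun j _ => (hY j).le
    rw [norm_mul, Real.norm_eq_abs, Real.norm_of_nonneg h5]
    calc |X n ω| * ∏ j ∈ Finset.range (n + 1), Y j ω ≤ t⁻¹ ^ n * (t ^ 2) ^ (n + 1) := by gcongr
      _ = t ^ 2 * t ^ n * (t⁻¹ ^ n * t ^ n) := by ring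
      _ = t ^ 2 * t ^ n := by rw [← mul_pow, inv_mul_cancel₀ ht0.ne']; simp
  exact tendsto_nhds_limUnder ⟨_, hsum.hasSum.tendsto_sum_nat⟩

end Convergence

/-! ### Tail asymptotics of the discounted sums and their maxima -/

theorem theorem2p1 {Ω : Type*} [MeasurableSpace Ω] (P : Measure Ω) [IsProbabilityMeasure P]
    (X Y : ℕ → Ω → ℝ) (F G : Measure ℝ) (α : ℝ)
    (hXm : ∀ i, Measurable (X i)) (hYm : ∀ i, Measurable (Y i))
    (hXlaw : ∀ i, P.map (X i) = F) (hYlaw : ∀ i, P.map (Y i) = G)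
    (hG : G (Set.Iic 0) = 0)
    (hXind : iIndepFun X P) (hYind : iIndepFun Y P)
    (hXY : IndepFun (fun ω i => X i ω) (fun ω i => Y i ω) P)
    (hA : ∀ p : ℝ, 0 < p → p < 1 → StronglyRegVar α (convexComb p F G)) :
    -- (a)
    (Integrable (fun y : ℝ => y ^ α) G ∧
      ∀ n : ℕ, 1 ≤ n →
        (Integrable (fun ω => posPow α (M X Y n ω)) P ∧
          (fun x : ℝ => P.real {ω | x < M X Y n ω}) ~[atTop]
            (fun x => coeffA (moment_G α G) n * tail F x
              + coeffBC P α (moment_G α G) (M X Y) n * tail G x)) ∧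
        (Integrable (fun ω => posPow α (S X Y n ω)) P ∧
          (fun x : ℝ => P.real {ω | x < S X Y n ω}) ~[atTop]
            (fun x => coeffA (moment_G α G) n * tail F x
              + coeffBC P α (moment_G α G) (S X Y) n * tail G x))) ∧
    -- (b)
    (moment_G α G < 1 →
      (∀ᵐ ω ∂P, Tendsto (fun n => M X Y n ω) atTop (𝓝 (Minf X Y ω))) ∧
      Integrable (fun ω => posPow α (Minf X Y ω)) P ∧
      (fun x : ℝ => P.real {ω | x < Minf X Y ω}) ~[atTop]
        (fun x => coeffAinf (moment_G α G) * tail F x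
          + coeffBCinf P α (moment_G α G) (Minf X Y) * tail G x)) ∧
    -- (c)
    (moment_G α G < 1 → Integrable (fun x : ℝ => Real.log (max (max (-x) 0) 1)) F →
      (∀ᵐ ω ∂P, Tendsto (fun n => S X Y n ω) atTop (𝓝 (Sinf X Y ω))) ∧
      Integrable (fun ω => posPow α (Sinf X Y ω)) P ∧
      (fun x : ℝ => P.real {ω | x < Sinf X Y ω}) ~[atTop]
        (fun x => coeffAinf (moment_G α G) * tail F x
          + coeffBCinf P α (moment_G α G) (Sinf X Y) * tail G x)) := by
  have h : IIDModel P X Y F G := ⟨hXm, hYm, hXlaw, hYlaw, hXind, hYind, hXY⟩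
  have := h.isProbabilityMeasure_left
  have := h.isProbabilityMeasure_right
  have hp := regPair_of_convexComb hA
  have hmS := measurable_S hXm hYm
  have hmM := measurable_M hXm hYm
  have hmSi := measurable_Sinf hXm hYm
  have hmMi := measurable_Minf hXm hYm
  have hpow : (fun y : ℝ => y ^ α) =ᵐ[G] posPow α := by
    filter_upwards [ae_pos_of_measure_Iic hG] with y hy
    exact (posPow_eq_of_pos hy).symm
  have hmom : moment_G α G = ∫ y, posPow α y ∂G := integral_congr_ae hpow
  have hμ0 : 0 < ∫ y, posPow α y ∂G := hp.moment_pos hG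
  have hlaw : ∀ {Z : Ω → ℝ}, Measurable Z →
      ∫ z, posPow α z ∂(P.map Z) = ∫ ω, posPow α (Z ω) ∂P := fun hZ =>
    integral_map hZ.aemeasurable (measurable_posPow α).aestronglyMeasurable
  have hprob : ∀ {Z : Ω → ℝ}, Measurable Z → IsProbabilityMeasure (P.map Z) := fun hZ =>
    Measure.isProbabilityMeasure_map hZ.aemeasurable
  have : ∀ n, IsProbabilityMeasure (P.map (S X Y n)) := fun n => hprob (hmS n)
  have : ∀ n, IsProbabilityMeasure (P.map (M X Y n)) := fun n => hprob (hmM n)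
  have := hprob hmSi
  have := hprob hmMi
  rw [hmom]
  set μ := ∫ y, posPow α y ∂G with hμ
  -- part (a) for a sequence whose laws obey the recursion
  have finite : ∀ Z : ℕ → Ω → ℝ, (∀ n, Measurable (Z n)) →
      (∀ x, 0 ≤ x → tail (P.map (Z 0)) x = 0) →
      (∀ n x, 0 ≤ x →
        tail (P.map (Z (n + 1))) x = tail (G.mconv (F.conv (P.map (Z n)))) x) →
      ∀ n, 1 ≤ n → Integrable (fun ω => posPow α (Z n ω)) P ∧
        (fun x : ℝ => P.real {ω | x < Z n ω}) ~[atTop]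
          fun x => coeffA μ n * tail F x + coeffBC P α μ Z n * tail G x := by
    intro Z hZ h0 hrec n hn
    have : ∀ n, IsProbabilityMeasure (P.map (Z n)) := fun n => hprob (hZ n)
    have hB : momentCoeff μ (fun k => ∫ z, posPow α z ∂(P.map (Z k))) n = coeffBC P α μ Z n := by
      simp only [momentCoeff, coeffBC, hlaw (hZ _)]
    have hm0 : ∀ k, 0 ≤ ∫ z, posPow α z ∂(P.map (Z k)) := fun k =>
      integral_nonneg (posPow_nonneg α)
    have ht := hp.tailWithin_iterate hG (U := fun k => P.map (Z k)) h0 hrec n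
    have hB0 := momentCoeff_nonneg hμ0.le hm0 n
    have hi := ht.integrable_posPow hp (coeffA_nonneg hμ0.le n) hB0 le_rfl
    refine ⟨hi.comp_measurable (hZ n), ?_⟩
    obtain ⟨k, rfl⟩ : ∃ k, n = k + 1 := ⟨n - 1, by omega⟩
    have he := ht.isEquivalent hp hG (coeffA_pos hμ0 hn) hB0 (hrec k) fun hz => by
      rw [momentCoeff_succ hμ0.ne'] at hz
      have h1 := mul_nonneg hμ0.le (momentCoeff_nonneg hμ0.le hm0 k)
      have h2 := mul_nonneg (inv_pos.2 hμ0).le (hm0 (k + 1))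
      exact (mul_eq_zero.1 (by linarith : μ⁻¹ * ∫ z, posPow α z ∂(P.map (Z (k + 1))) = 0)).resolve_left
        (inv_pos.2 hμ0).ne'
    rw [hB] at he
    simp_rw [← tail_map_eq (hZ (k + 1)).aemeasurable]
    exact he
  -- the tail of a limit whose law the recursion preserves
  have limit : μ < 1 → ∀ κ, 0 ≤ κ → ∀ Z : Ω → ℝ, Measurable Z →
      (∀ x, 0 ≤ x → tail (P.map Z) x ≤ κ * tailSum F G x) →
      (∀ x, 0 ≤ x → tail (P.map Z) x = tail (G.mconv (F.conv (P.map Z))) x) →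
      Integrable (fun ω => posPow α (Z ω)) P ∧
        (fun x : ℝ => P.real {ω | x < Z ω}) ~[atTop]
          fun x => coeffAinf μ * tail F x + coeffBCinf P α μ Z * tail G x := by
    intro hμ1 κ hκ Z hZ hb hfix
    have := hprob hZ
    have hd : 0 < μ * (1 - μ) := mul_pos hμ0 (by linarith)
    have ht := hp.tailWithin_fixedPoint hG hμ1 hκ hb hfix
    have hA0 : 0 < coeffAinf μ := div_pos hμ0 (by linarith)
    have hB0 : 0 ≤ (∫ z, posPow α z ∂(P.map Z)) / (μ * (1 - μ)) :=
      div_nonneg (integral_nonneg (posPow_nonneg α)) hd.le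
    have hi := ht.integrable_posPow hp hA0.le hB0 le_rfl
    refine ⟨hi.comp_measurable hZ, ?_⟩
    have he := ht.isEquivalent hp hG hA0 hB0 hfix fun hz =>
      (div_eq_zero_iff.1 hz).resolve_right hd.ne'
    simp_rw [← tail_map_eq hZ.aemeasurable]
    rw [hlaw hZ] at he
    exact he
  have hM0 : ∀ x, 0 ≤ x → tail (P.map (M X Y 0)) x = 0 := fun x hx => tail_map_zero (M_zero X Y) hx
  have hMrec : ∀ n x, 0 ≤ x →
      tail (P.map (M X Y (n + 1))) x = tail (G.mconv (F.conv (P.map (M X Y n)))) x :=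
    fun n x hx => h.tail_map_M_succ hG n hx
  have bound : μ < 1 → ∃ κ, 0 ≤ κ ∧
      ∀ n x, 0 ≤ x → tail (P.map (M X Y n)) x ≤ κ * tailSum F G x := fun hμ1 =>
    hp.exists_uniform_tail_bound hG hμ1 hM0 hMrec
  refine ⟨⟨hp.intG.congr hpow.symm, fun n hn => ⟨finite _ hmM hM0 hMrec n hn,
    finite _ hmS (fun x hx => tail_map_zero (S_zero X Y) hx)
      (fun k x _ => congrArg (fun U => tail U x) (h.map_S_succ k)) n hn⟩⟩, fun hμ1 => ?_,
    fun hμ1 hlog => ?_⟩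
  · obtain ⟨κ, hκ0, hκ⟩ := bound hμ1
    have hbdd := h.ae_bddAbove_M hκ
    have hconv : ∀ᵐ ω ∂P, Tendsto (fun n => M X Y n ω) atTop (𝓝 (Minf X Y ω)) := by
      filter_upwards [hbdd] with ω hω using tendsto_Minf_of_bddAbove hω
    refine ⟨hconv, limit hμ1 κ hκ0 _ hmMi (fun x hx => ?_) fun x hx => h.tail_map_Minf hG hbdd hx⟩
    refine (tail_map_le_of_forall_lt hmMi.aemeasurable ?_).trans
      (h.measureReal_exists_lt_M_le hκ hx)
    filter_upwards [hconv] with ω hω hlt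
    exact (hω.eventually_const_lt hlt).exists
  · obtain ⟨κ, hκ0, hκ⟩ := bound hμ1
    -- for `α = 0` the moment would be `1`
    have hα : 0 < α := by
      refine lt_of_le_of_ne hp.nonneg fun h0 => ?_
      rw [← hmom, moment_G, ← h0] at hμ1
      simp at hμ1
    have hconv := h.ae_tendsto_Sinf hp hα hG hμ1 hlog
    refine ⟨hconv, limit hμ1 κ hκ0 _ hmSi (fun x hx => ?_) fun x _ =>
      congrArg (fun U => tail U x) (h.map_Sinf hG hconv)⟩
    refine (tail_map_le_of_forall_lt hmSi.aemeasurable ?_).trans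
      (h.measureReal_exists_lt_M_le hκ hx)
    filter_upwards [hconv] with ω hω hlt
    obtain ⟨n, hn⟩ := (hω.eventually_const_lt hlt).exists
    exact ⟨n, hn.trans_le (S_le_M X Y n ω)⟩
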